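/- For a prime $p$ let $\Gamma = \{ m^p \bmod p^2 : 1 \le m \le p-1 \} \subseteq \mathbb{Z}/p^2\mathbb{Z}$ (a subgroup of the multiplicative group $(\mathbb{Z}/p^2\mathbb{Z})^*$), and let $$\mathsf{E}(\Gamma) = \bigl|\{ (a_1,a_2,b_1,b_2) \in \Gamma^4 : a_1 + b_1 = a_2 + b_2 \}\bigr|$$ be its additive energy. There is an absolute constant $C > 0$ such that for every prime $p \ge 3$ $$\mathsf{E}(\Gamma) \le C\, |\Gamma|^{42/17} \, (\log_2 |\Gamma|)^{10/17} .$$ -/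

import Mathlib

/-- Heilbronn's subgroup `Γ = {m ^ p : 1 ≤ m ≤ p - 1}` of `ℤ / p²ℤ`, as a finite set of residues. -/
def heilbronnGroup (p : ℕ) : Finset (ZMod (p ^ 2)) :=
  (Finset.Icc 1 (p - 1)).image fun m : ℕ => (m : ZMod (p ^ 2)) ^ p

/-!
Write `Γ` for Heilbronn's group, `n = |Γ| = p - 1`, and `r x` for the number of representations
of `x` as a difference of two elements of `Γ`, so that the energy is `E = ∑ r²`. The proof
combines a tail bound for `r`, obtained by Stepanov's method, with a count of triples in `Γ`.

**Tail bound.** If `f` is the reduction modulo `p` of `((X - 1)^p - X^p + 1) / p`, then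
`a^p - (a - 1)^p = 1 - p f(a)` in `ℤ/p²`, so up to scaling by `Γ` the number `r x` counts the
`a ∈ ℤ/p` at which `f` takes a given value. As `(1 - X) f' = 1 - X^(p - 1)`, the polynomial `f`
behaves like a truncated logarithm: the products `(1 - X)^i f^j X^(pk)` with `i < A`, `j < B` and
`A B ≤ p` are linearly independent (`auxPolynomial_ne_zero`), whereas the derivatives of such a
product, evaluated where `f` equals `t`, are given by polynomials of small degree
(`exists_eval_eulerDeriv_monomial`). A nonzero combination vanishing to high order at all points
of `f⁻¹(T)` therefore exists, and comparing degrees gives `|f⁻¹(T)|³ ≪ p² |T|²`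
(`card_preimage_truncatedLog_le`). Hence `r x ≥ k` for `O(n³ / k³)` nonzero `x`
(`card_levelSet_le`), and summation over `k` bounds the moments of `r`; in particular
`∑ r³ ≪ n³ log n`.

**Triples.** Let `g` be `r` cut off at `τ ≍ n³ / E`, which keeps at least half of `E`. The kernel
`r (a - c)` is positive semidefinite, and `g (a - b)` has constant row sums `μ ≍ E / n` on `Γ`, so
`∑ g(a - b) g(b - c) r(a - c) ≥ μ² E / n ≫ E³ / n³`, the sum being over triples of `Γ`
(`sq_mul_energy_le_triple`). The `a - c` with `r (a - c)` above `P ≍ n⁸ / E³` contribute only a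
fraction of this (`triple_le_truncRep_add`). For the others, with `v` equal to `r` cut off at `P`,
Cauchy–Schwarz bounds the sum by the square root of
`(∑ r³) · ∑ g(x)² g(y)² v(x + y)²` (`sq_triple_le_energy_three`).

**The last sum.** Splitting it according to `x` modulo `p` and applying Cauchy–Schwarz again reduces
it to the correlations `M(s) = ∑ u(y) u(y + s)`, `u = g²`, for `s` divisible by `p`. Since `Γ` acts
freely on the nonzero `s` of this kind, and `M` is invariant, each of these `M(s)` is small
(`sq_weighted_count_le`). Altogether `E¹⁷ ≪ n⁴² (log n)²`, which is stronger than what is needed.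
-/

section

open Polynomial

/-! ### Stepanov's method for a truncated logarithm -/

/-- A polynomial `f` with `(1 - X) f' = 1 - X ^ (p - 1)` is a logarithm to high order at `0`: a
combination of `(1 - X) ^ i` with coefficients `Q i` in `K[f]` that vanishes at `0` to at least as
high an order as the number of coefficients available is trivial. The operator `(1 - X) d/dX + i₀`
lowers the degree of `Q i₀`, preserves the degrees of the others, and costs one order of
vanishing. -/
theorem truncatedLog_linearIndependent {p : ℕ} [Fact p.Prime] {f : (ZMod p)[X]}
    (hf : (1 - X) * derivative f = 1 - X ^ (p - 1)) {A : ℕ} (hA : A ≤ p) :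
    ∀ (m : ℕ) (d : ℕ → ℕ) (Q : ℕ → (ZMod p)[X]), m ≤ p → ∑ i ∈ Finset.range A, d i ≤ m →
      (∀ i ∈ Finset.range A, (Q i).degree < d i) →
      X ^ m ∣ ∑ i ∈ Finset.range A, (1 - X) ^ i * (Q i).comp f →
      ∀ i ∈ Finset.range A, Q i = 0 := by
  intro m
  induction m with
  | zero =>
    intro d Q _ hd hQ _ i hi
    have h0 : d i = 0 := by
      have := Finset.single_le_sum (f := d) (fun _ _ => Nat.zero_le _) hi
      omega
    have := hQ i hi
    rw [h0] at this
    simpa using this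
  | succ m ih =>
    intro d Q hm hd hQ hdvd
    by_contra hne
    push Not at hne
    obtain ⟨i₀, hi₀, hQ₀⟩ := hne
    have hd₀ : 0 < d i₀ := by
      rcases Nat.eq_zero_or_pos (d i₀) with h | h
      · have := hQ i₀ hi₀
        rw [h] at this
        exact absurd (by simpa using this) hQ₀
      · exact h
    -- the operator `(1 - X) d/dX + i₀` lowers the degree of `Q i₀` and loses one power of `X`
    have key := ih (Function.update d i₀ (d i₀ - 1))
      (fun i => ((i₀ : ZMod p) - i) • Q i + derivative (Q i)) (by omega) ?_ ?_ ?_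
    · have hother : ∀ i ∈ Finset.range A, i ≠ i₀ → Q i = 0 := by
        intro i hi hne
        by_contra hQi
        have h := key i hi
        have hc : ((i₀ : ZMod p) - i) ≠ 0 := by
          rw [sub_ne_zero]
          intro h
          have h' := (ZMod.natCast_eq_natCast_iff' _ _ _).1 h
          rw [Nat.mod_eq_of_lt (by have := Finset.mem_range.1 hi₀; omega),
            Nat.mod_eq_of_lt (by have := Finset.mem_range.1 hi; omega)] at h'
          exact hne h'.symm
        have h1 : ((i₀ : ZMod p) - i) • Q i = - derivative (Q i) := eq_neg_of_add_eq_zero_left h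
        have h2 := congrArg degree h1
        rw [degree_smul_of_smul_regular _ (IsSMulRegular.of_ne_zero hc), degree_neg] at h2
        exact absurd (degree_derivative_lt hQi) (by rw [h2]; exact lt_irrefl _)
      have hder : derivative (Q i₀) = 0 := by simpa using key i₀ hi₀
      have hdp : (Q i₀).degree < p := by
        refine (hQ i₀ hi₀).trans_le ?_
        have := Finset.single_le_sum (f := d) (fun _ _ => Nat.zero_le _) hi₀
        exact_mod_cast (by omega : d i₀ ≤ p)
      have hconst : Q i₀ = C ((Q i₀).coeff 0) := by
        ext n
        rcases Nat.eq_zero_or_pos n with rfl | hn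
        · simp
        rw [coeff_C_of_ne_zero hn.ne']
        rcases lt_or_ge n p with hnp | hnp
        · have h := congrArg (fun q => coeff q (n - 1)) hder
          simp only [coeff_derivative, coeff_zero] at h
          have e : n - 1 + 1 = n := by omega
          rw [e] at h
          rcases mul_eq_zero.1 h with h | h
          · exact h
          · exfalso
            have h' : ((n : ℕ) : ZMod p) = 0 := by
              rw [← h]; conv_lhs => rw [← e]
              push_cast; ring
            rw [ZMod.natCast_eq_zero_iff] at h'
            exact absurd (Nat.le_of_dvd hn h') (by omega)
        · exact coeff_eq_zero_of_degree_lt (hdp.trans_le (by exact_mod_cast hnp))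
      rw [Finset.sum_eq_single i₀ (fun i hi hne => by rw [hother i hi hne]; simp)
        (fun h => absurd hi₀ h), hconst, C_comp] at hdvd
      have h0 : X ∣ (1 - X) ^ i₀ * C ((Q i₀).coeff 0) :=
        (dvd_pow_self X (Nat.succ_ne_zero m)).trans hdvd
      rw [X_dvd_iff, coeff_zero_eq_eval_zero] at h0
      simp at h0
      rw [h0] at hconst
      exact hQ₀ (by simpa using hconst)
    · have h1 : ∑ i ∈ Finset.range A, Function.update d i₀ (d i₀ - 1) i + 1
          = ∑ i ∈ Finset.range A, d i := by
        rw [Finset.sum_update_of_mem hi₀, ← Finset.add_sum_erase _ d hi₀,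
          Finset.sdiff_singleton_eq_erase]
        omega
      omega
    · intro i hi
      by_cases h : i = i₀
      · subst h
        simp only [sub_self, zero_smul, zero_add, Function.update_self]
        have h := degree_derivative_lt hQ₀
        have h2 := hQ i hi
        rw [degree_eq_natDegree hQ₀] at h h2
        have h3 : (Q i).natDegree < d i := by exact_mod_cast h2
        exact h.trans_le (by exact_mod_cast (by omega : (Q i).natDegree ≤ d i - 1))
      · rw [Function.update_of_ne h]
        refine (degree_add_le _ _).trans_lt (max_lt ?_ ?_)
        · exact (degree_smul_le _ _).trans_lt (hQ i hi)
        · exact (degree_derivative_le).trans_lt (hQ i hi)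
    · obtain ⟨S, hS⟩ := hdvd
      have hp1 : m ≤ p - 1 := by omega
      obtain ⟨e, he⟩ := Nat.exists_eq_add_of_le hp1
      have hsum : ∑ i ∈ Finset.range A, (1 - X) ^ i *
            (((i₀ : ZMod p) - i) • Q i + derivative (Q i)).comp f
          = (1 - X) * derivative (∑ i ∈ Finset.range A, (1 - X) ^ i * (Q i).comp f)
            + (i₀ : (ZMod p)[X]) * (∑ i ∈ Finset.range A, (1 - X) ^ i * (Q i).comp f)
            + X ^ (p - 1) * ∑ i ∈ Finset.range A, (1 - X) ^ i * (derivative (Q i)).comp f := by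
        rw [derivative_sum, Finset.mul_sum, Finset.mul_sum, Finset.mul_sum,
          ← Finset.sum_add_distrib, ← Finset.sum_add_distrib]
        refine Finset.sum_congr rfl fun i _ => ?_
        have h1 : (1 - X) * derivative ((1 - X : (ZMod p)[X]) ^ i)
            = - (i : (ZMod p)[X]) * (1 - X) ^ i := by
          rcases i with _ | i
          · simp
          · rw [derivative_pow]; simp; ring
        rw [derivative_mul, derivative_comp, add_comp, smul_comp, smul_eq_C_mul]
        have hX : (X : (ZMod p)[X]) ^ (p - 1) = 1 - (1 - X) * derivative f := by rw [hf]; ring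
        rw [hX]
        simp only [map_sub, map_natCast]
        linear_combination (-(Q i).comp f) * h1
      rw [hsum, hS, he]
      refine dvd_add (dvd_add ?_ ?_) ?_
      · rw [derivative_mul, derivative_X_pow, Nat.add_sub_cancel]
        exact Dvd.intro (((1 - X) * (C ((m + 1 : ℕ) : ZMod p) * S + X * derivative S))) (by
          rw [pow_succ]; ring)
      · exact Dvd.intro ((i₀ : (ZMod p)[X]) * X * S) (by rw [pow_succ]; ring)
      · exact Dvd.intro _ (by rw [pow_add, mul_assoc])

/-- The derivation `X (1 - X) d/dX` of `K[X]`, as a linear map. -/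
noncomputable def eulerDeriv (K : Type*) [CommRing K] : K[X] →ₗ[K] K[X] :=
  LinearMap.mulLeft K (X * (1 - X)) ∘ₗ derivative

theorem eulerDeriv_apply {K : Type*} [CommRing K] (h : K[X]) :
    eulerDeriv K h = X * (1 - X) * derivative h := rfl

/-- The `k`-th iterate of `X (1 - X) d/dX` sees the leading coefficient at a zero of order `k`. -/
theorem eval_eulerDeriv_pow_mul {K : Type*} [CommRing K] (x : K) (k : ℕ) :
    ∀ h : K[X], ((eulerDeriv K ^ k) ((X - C x) ^ k * h)).eval x
      = (k.factorial : K) * (x * (1 - x)) ^ k * h.eval x := by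
  induction k with
  | zero => intro h; simp
  | succ k ih =>
    intro h
    have h1 : eulerDeriv K ((X - C x) ^ (k + 1) * h) = (X - C x) ^ k *
        ((k + 1 : K[X]) * (X * (1 - X)) * h + (X - C x) * eulerDeriv K h) := by
      simp only [eulerDeriv_apply, derivative_mul, derivative_pow, Nat.add_sub_cancel]
      simp
      ring
    rw [pow_succ, Module.End.mul_apply, h1, ih, Nat.factorial_succ]
    simp
    ring

theorem pow_dvd_of_eulerDeriv_eval_eq_zero {p : ℕ} [Fact p.Prime] {Ψ : (ZMod p)[X]} {x : ZMod p}
    (hx0 : x ≠ 0) (hx1 : x ≠ 1) {M : ℕ} (hM : M ≤ p)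
    (h : ∀ m < M, ((eulerDeriv (ZMod p) ^ m) Ψ).eval x = 0) : (X - C x) ^ M ∣ Ψ := by
  induction M with
  | zero => simp
  | succ M ih =>
    obtain ⟨g, hg⟩ := ih (by omega) fun m hm => h m (by omega)
    have h1 := h M (by omega)
    rw [hg, eval_eulerDeriv_pow_mul] at h1
    have hfac : ((M.factorial : ℕ) : ZMod p) ≠ 0 := by
      rw [Ne, ZMod.natCast_eq_zero_iff, (Fact.out : p.Prime).dvd_factorial]
      omega
    have hxx : (x * (1 - x)) ^ M ≠ 0 :=
      pow_ne_zero _ (mul_ne_zero hx0 (sub_ne_zero.2 (Ne.symm hx1)))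
    have hgx : g.eval x = 0 := by
      rcases mul_eq_zero.1 h1 with h2 | h2
      · exact absurd h2 (mul_ne_zero hfac hxx)
      · exact h2
    obtain ⟨g', hg'⟩ := dvd_iff_isRoot.2 hgx
    exact ⟨g', by rw [hg, hg', pow_succ, mul_assoc]⟩

/-- On the level set `f = t`, where moreover `x ^ p = x`, each iterate of `X (1 - X) d/dX` on
`(1 - X) ^ a * f ^ b * X ^ (p * c)` agrees with a polynomial of degree at most `a + c + m`; the
degree of `f` does not enter. -/
theorem exists_eval_eulerDeriv_monomial {p : ℕ} [Fact p.Prime] {f : (ZMod p)[X]}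
    (hf : (1 - X) * derivative f = 1 - X ^ (p - 1)) (t : ZMod p) (m : ℕ) :
    ∀ a b c : ℕ, ∃ q ∈ degreeLT (ZMod p) (a + c + m + 1), ∀ x, f.eval x = t →
      ((eulerDeriv (ZMod p) ^ m) ((1 - X) ^ a * f ^ b * X ^ (p * c))).eval x = q.eval x := by
  induction m with
  | zero =>
    intro a b c
    refine ⟨(1 - X) ^ a * C (t ^ b) * X ^ c, ?_, ?_⟩
    · rw [mem_degreeLT]
      refine (degree_le_natDegree).trans_lt ?_
      have h1 : ((1 - X : (ZMod p)[X]) ^ a * C (t ^ b) * X ^ c).natDegree ≤ a + c := by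
        have : (1 - X : (ZMod p)[X]).natDegree ≤ 1 := by compute_degree
        compute_degree!
      exact_mod_cast (by omega)
    · intro x hx
      simp [hx, pow_mul]
  | succ m ih =>
    intro a b c
    obtain ⟨q1, hq1, h1⟩ := ih a b c
    obtain ⟨q2, hq2, h2⟩ := ih (a + 1) b c
    obtain ⟨q3, hq3, h3⟩ := ih a (b - 1) c
    obtain ⟨q4, hq4, h4⟩ := ih (a + 1) (b - 1) c
    obtain ⟨q5, hq5, h5⟩ := ih a (b - 1) (c + 1)
    refine ⟨-(a : ZMod p) • q1 + (a : ZMod p) • q2 + (b : ZMod p) • q3 - (b : ZMod p) • q4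
      - (b : ZMod p) • q5, ?_, ?_⟩
    · have mono : ∀ {n}, n ≤ a + c + (m + 1) + 1 → ∀ {q}, q ∈ degreeLT (ZMod p) n →
          ∀ s : ZMod p, s • q ∈ degreeLT (ZMod p) (a + c + (m + 1) + 1) := fun hn _ hq s =>
        Submodule.smul_mem _ _ (degreeLT_mono hn hq)
      exact Submodule.sub_mem _ (Submodule.sub_mem _ (Submodule.add_mem _ (Submodule.add_mem _
        (mono (by omega) hq1 _) (mono (by omega) hq2 _)) (mono (by omega) hq3 _))
        (mono (by omega) hq4 _)) (mono (by omega) hq5 _)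
    · intro x hx
      have hp : 1 ≤ p := (Fact.out : p.Prime).one_lt.le
      have hD : eulerDeriv (ZMod p) ((1 - X) ^ a * f ^ b * X ^ (p * c)) =
          -(a : ZMod p) • ((1 - X) ^ a * f ^ b * X ^ (p * c))
          + (a : ZMod p) • ((1 - X) ^ (a + 1) * f ^ b * X ^ (p * c))
          + (b : ZMod p) • ((1 - X) ^ a * f ^ (b - 1) * X ^ (p * c))
          - (b : ZMod p) • ((1 - X) ^ (a + 1) * f ^ (b - 1) * X ^ (p * c))
          - (b : ZMod p) • ((1 - X) ^ a * f ^ (b - 1) * X ^ (p * (c + 1))) := by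
        have e1 : (1 - X) * derivative ((1 - X : (ZMod p)[X]) ^ a)
            = - (a : (ZMod p)[X]) * (1 - X) ^ a := by
          rcases a with _ | a
          · simp
          · rw [derivative_pow]; simp; ring
        have e2 : derivative (X ^ (p * c) : (ZMod p)[X]) = 0 := by
          rw [derivative_X_pow]; simp
        have e3 : (X : (ZMod p)[X]) * X ^ (p - 1) = X ^ p := by
          rw [← pow_succ', Nat.sub_add_cancel hp]
        rw [eulerDeriv_apply, derivative_mul, derivative_mul, e2, derivative_pow f]
        simp only [smul_eq_C_mul, map_neg, map_natCast, mul_add, pow_add, mul_one]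
        rw [← e3]
        linear_combination (X * f ^ b * X ^ (p * c)) * e1 +
          (X * (1 - X) ^ a * (b : (ZMod p)[X]) * f ^ (b - 1) * X ^ (p * c)) * hf
      rw [pow_succ, Module.End.mul_apply, hD]
      simp only [map_add, map_sub, map_smul, eval_add, eval_sub, eval_smul, h1 x hx, h2 x hx,
        h3 x hx, h4 x hx, h5 x hx]

/-- The products `(1 - X) ^ i * f ^ j * X ^ (p * k)` with `i < A`, `j < B` are linearly independent
if `A * B ≤ p`: the terms with the least `k` that occurs would have to cancel modulo `X ^ p`. -/
theorem auxPolynomial_ne_zero {p : ℕ} [Fact p.Prime] {f : (ZMod p)[X]}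
    (hf : (1 - X) * derivative f = 1 - X ^ (p - 1)) {A B : ℕ} (hAB : A * B ≤ p) (hAp : A ≤ p)
    (c : ℕ → ℕ → ℕ → ZMod p) (D : ℕ)
    (h : ∑ k ∈ Finset.range D, ∑ i ∈ Finset.range A, ∑ j ∈ Finset.range B,
      C (c i j k) * ((1 - X) ^ i * f ^ j * X ^ (p * k)) = 0) :
    ∀ k < D, ∀ i < A, ∀ j < B, c i j k = 0 := by
  intro k
  induction k using Nat.strong_induction_on with
  | _ k ih =>
  intro hk i hi j hj
  have hQ := truncatedLog_linearIndependent hf hAp p (fun _ => B)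
    (fun i => ∑ j ∈ Finset.range B, C (c i j k) * X ^ j) le_rfl (by simpa using hAB) ?_ ?_ i
    (Finset.mem_range.2 hi)
  · have := congrArg (fun q => coeff q j) hQ
    simpa [coeff_X_pow, hj] using this
  · intro i _
    refine mem_degreeLT.1 (Submodule.sum_mem _ fun j hj => mem_degreeLT.2 ?_)
    exact (degree_C_mul_X_pow_le _ _).trans_lt (by exact_mod_cast Finset.mem_range.1 hj)
  · set G : ℕ → (ZMod p)[X] := fun k => ∑ i ∈ Finset.range A, ∑ j ∈ Finset.range B,
      C (c i j k) * ((1 - X) ^ i * f ^ j) with hG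
    have h' : ∑ k ∈ Finset.range D, X ^ (p * k) * G k = 0 := by
      rw [← h]
      refine Finset.sum_congr rfl fun k _ => ?_
      rw [hG, Finset.mul_sum]
      refine Finset.sum_congr rfl fun i _ => ?_
      rw [Finset.mul_sum]
      refine Finset.sum_congr rfl fun j _ => ?_
      ring
    have hGk : ∑ i ∈ Finset.range A, (1 - X) ^ i *
        (∑ j ∈ Finset.range B, C (c i j k) * X ^ j).comp f = G k := by
      refine Finset.sum_congr rfl fun i _ => ?_
      rw [comp, eval₂_finsetSum, Finset.mul_sum]
      refine Finset.sum_congr rfl fun j _ => ?_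
      simp
      ring
    rw [hGk]
    rw [← Finset.add_sum_erase _ _ (Finset.mem_range.2 hk)] at h'
    have hd : (X : (ZMod p)[X]) ^ (p * k) * X ^ p ∣ X ^ (p * k) * G k := by
      rw [eq_neg_of_add_eq_zero_left h', dvd_neg]
      refine Finset.dvd_sum fun l hl => ?_
      obtain ⟨hlk, hlD⟩ := Finset.mem_erase.1 hl
      rcases lt_or_gt_of_ne hlk with hlt | hgt
      · have : G l = 0 := Finset.sum_eq_zero fun i hi => Finset.sum_eq_zero fun j hj => by
          rw [ih l hlt (Finset.mem_range.1 hlD) i (Finset.mem_range.1 hi) j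
            (Finset.mem_range.1 hj)]
          simp
        rw [this]; simp
      · refine Dvd.dvd.mul_right ?_ _
        rw [← pow_add]
        exact pow_dvd_pow _ (by nlinarith)
    exact (mul_dvd_mul_iff_left (pow_ne_zero _ X_ne_zero)).1 hd

/-- Stepanov's method: if there are more coefficients than vanishing conditions, some nonzero
combination of the products `(1 - X) ^ i * f ^ j * X ^ (p * k)` vanishes to order `M` at every point
of `S`. -/
theorem stepanov_bound {p : ℕ} [Fact p.Prime] {f : (ZMod p)[X]}
    (hf : (1 - X) * derivative f = 1 - X ^ (p - 1)) (hdeg : f.natDegree ≤ p)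
    {T S : Finset (ZMod p)} (hS : ∀ x ∈ S, x ≠ 0 ∧ x ≠ 1 ∧ f.eval x ∈ T) {A B M : ℕ}
    (hAB : A * B ≤ p) (hB : 1 ≤ B) (hM : M ≤ p)
    (hcount : T.card * (M * (A + B + M)) < A * (B * B)) :
    S.card * M ≤ A + 2 * p * B := by
  have hAp : A ≤ p := (Nat.le_mul_of_pos_right A hB).trans hAB
  choose q hq hqe using fun t m => exists_eval_eulerDeriv_monomial hf t m
  -- one linear condition for each coefficient of each of the polynomials expressing the derivatives
  let N : Matrix (T × Fin M × Fin (A + B + M)) (Fin A × Fin B × Fin B) (ZMod p) := fun κ ι =>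
    (q κ.1 κ.2.1 ι.1 ι.2.1 ι.2.2).coeff κ.2.2
  have hker : N.mulVecLin.ker ≠ ⊥ := by
    apply LinearMap.ker_ne_bot_of_finrank_lt
    simpa using hcount
  obtain ⟨v, hv, hv0⟩ := (Submodule.ne_bot_iff _).1 hker
  rw [LinearMap.mem_ker, Matrix.mulVecLin_apply] at hv
  let c : ℕ → ℕ → ℕ → ZMod p := fun i j k =>
    if h : i < A ∧ j < B ∧ k < B then v (⟨i, h.1⟩, ⟨j, h.2.1⟩, ⟨k, h.2.2⟩) else 0
  set Ψ : (ZMod p)[X] := ∑ k ∈ Finset.range B, ∑ i ∈ Finset.range A, ∑ j ∈ Finset.range B,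
      C (c i j k) * ((1 - X) ^ i * f ^ j * X ^ (p * k)) with hΨ
  have hΨ0 : Ψ ≠ 0 := by
    intro h0
    apply hv0
    funext ⟨i, j, k⟩
    have := auxPolynomial_ne_zero hf hAB hAp c B h0 k k.2 i i.2 j j.2
    simpa [c] using this
  have hΨv : Ψ = ∑ ι : Fin A × Fin B × Fin B,
      v ι • ((1 - X) ^ (ι.1 : ℕ) * f ^ (ι.2.1 : ℕ) * X ^ (p * (ι.2.2 : ℕ))) := by
    rw [Fintype.sum_prod_type, hΨ, Finset.sum_comm, Finset.sum_range]
    refine Finset.sum_congr rfl fun i _ => ?_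
    rw [Fintype.sum_prod_type, Finset.sum_comm, Finset.sum_range]
    refine Finset.sum_congr rfl fun j _ => ?_
    rw [Finset.sum_range]
    refine Finset.sum_congr rfl fun k _ => ?_
    simp [c, smul_eq_C_mul]
  have hvanish : ∀ x ∈ S, (X - C x) ^ M ∣ Ψ := by
    intro x hx
    obtain ⟨hx0, hx1, hxT⟩ := hS x hx
    refine pow_dvd_of_eulerDeriv_eval_eq_zero hx0 hx1 hM fun m hm => ?_
    have hzero : ∑ ι : Fin A × Fin B × Fin B, v ι • q (f.eval x) m ι.1 ι.2.1 ι.2.2 = 0 := by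
      ext l
      rcases lt_or_ge l (A + B + M) with hl | hl
      · have h := congrFun hv (⟨f.eval x, hxT⟩, ⟨m, hm⟩, ⟨l, hl⟩)
        simp only [Matrix.mulVec, dotProduct, N, Pi.zero_apply] at h
        rw [finsetSum_coeff, coeff_zero, ← h]
        refine Finset.sum_congr rfl fun ι _ => ?_
        rw [coeff_smul, smul_eq_mul, mul_comm]
      · rw [finsetSum_coeff, coeff_zero]
        refine Finset.sum_eq_zero fun ι _ => ?_
        have h1 := mem_degreeLT.1 (hq (f.eval x) m ι.1 ι.2.1 ι.2.2)
        rw [coeff_smul, coeff_eq_zero_of_degree_lt (h1.trans_le ?_), smul_zero]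
        have := ι.1.2
        have := ι.2.2.2
        exact_mod_cast (by omega)
    rw [hΨv, map_sum, eval_finsetSum]
    have h2 := congrArg (eval x) hzero
    rw [eval_finsetSum, eval_zero] at h2
    rw [← h2]
    refine Finset.sum_congr rfl fun ι _ => ?_
    rw [map_smul, eval_smul, eval_smul, hqe (f.eval x) m _ _ _ x rfl]
  have hprod : ∏ x ∈ S, (X - C x) ^ M ∣ Ψ := by
    refine Finset.prod_dvd_of_coprime (fun x _ y _ hxy => ?_) hvanish
    exact (pairwise_coprime_X_sub_C (s := fun x : ZMod p => x) Function.injective_id hxy).pow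
  have hle := natDegree_le_of_dvd hprod hΨ0
  have hl : (∏ x ∈ S, (X - C x) ^ M).natDegree = S.card * M := by
    rw [natDegree_prod_of_monic _ _ fun x _ => (monic_X_sub_C x).pow M]
    simp
  rw [hl] at hle
  refine hle.trans (natDegree_sum_le_of_forall_le _ _ fun k hk => natDegree_sum_le_of_forall_le _ _
    fun i hi => natDegree_sum_le_of_forall_le _ _ fun j hj => ?_)
  have hi := Finset.mem_range.1 hi
  have hj := Finset.mem_range.1 hj
  have hk := Finset.mem_range.1 hk
  have h1 : (1 - X : (ZMod p)[X]).natDegree ≤ 1 := by compute_degree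
  refine (natDegree_C_mul_le _ _).trans (natDegree_mul_le.trans ?_)
  refine (Nat.add_le_add (natDegree_mul_le.trans
    (Nat.add_le_add (natDegree_pow_le_of_le i h1) (natDegree_pow_le_of_le j hdeg)))
    (natDegree_X_pow_le _)).trans ?_
  have hjp : j * p ≤ p * B := by rw [mul_comm]; exact Nat.mul_le_mul_left p hj.le
  have hkp : p * k ≤ p * B := Nat.mul_le_mul_left p hk.le
  rw [mul_assoc]
  omega

/-- Few arguments `x` have `f x` in a given set `T`: at most a constant times `(p |T|)^(2/3)`. -/
theorem card_preimage_truncatedLog_le {p : ℕ} [Fact p.Prime] {f : (ZMod p)[X]}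
    (hf : (1 - X) * derivative f = 1 - X ^ (p - 1)) (hdeg : f.natDegree ≤ p)
    {T S : Finset (ZMod p)} (hS : ∀ x ∈ S, x ≠ 0 ∧ x ≠ 1 ∧ f.eval x ∈ T) :
    S.card ^ 3 ≤ 4096000 * p ^ 2 * T.card ^ 2 := by
  have hp : 2 ≤ p := (Fact.out : p.Prime).two_le
  have hSp : S.card ≤ p := by simpa using Finset.card_le_univ S
  rcases Nat.eq_zero_or_pos T.card with hT | hT
  · rw [Finset.card_eq_zero] at hT
    have : S = ∅ := Finset.eq_empty_of_forall_notMem fun x hx => by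
      have := (hS x hx).2.2
      simp [hT] at this
    simp [this]
  set J := T.card with hJ
  -- `B` is the least integer that is at least the cube root of `p |T|`
  have hex : ∃ B : ℕ, p * J ≤ B ^ 3 := ⟨p * J, Nat.le_self_pow (by norm_num) _⟩
  obtain ⟨B, hB, hBmin⟩ : ∃ B : ℕ, p * J ≤ B ^ 3 ∧ ∀ b < B, b ^ 3 < p * J :=
    ⟨Nat.find hex, Nat.find_spec hex, fun b hb => not_le.1 (Nat.find_min hex hb)⟩
  have hpJ : 2 ≤ p * J := by nlinarith
  have hB2 : 2 ≤ B := by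
    by_contra h
    have : B ≤ 1 := by omega
    have : B ^ 3 ≤ 1 := Nat.pow_le_one_iff (by norm_num) |>.2 this
    omega
  have hB8 : B ^ 3 ≤ 8 * (p * J) := by
    have h1 := hBmin (B - 1) (by omega)
    have h2 : B ≤ 2 * (B - 1) := by omega
    calc B ^ 3 ≤ (2 * (B - 1)) ^ 3 := Nat.pow_le_pow_left h2 3
      _ = 8 * (B - 1) ^ 3 := by ring
      _ ≤ _ := by omega
  suffices h : S.card ≤ 40 * B ^ 2 by
    calc S.card ^ 3 ≤ (40 * B ^ 2) ^ 3 := Nat.pow_le_pow_left h 3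
      _ = 64000 * (B ^ 3) ^ 2 := by ring
      _ ≤ 64000 * (8 * (p * J)) ^ 2 := by gcongr
      _ = _ := by ring
  set A := p / B with hA
  have hAB : A * B ≤ p := Nat.div_mul_le_self p B
  have hpA : p < (A + 1) * B := by
    have := Nat.lt_mul_div_succ p (show 0 < B by omega)
    rw [mul_comm]; exact this
  by_cases hA4 : A < 4
  · nlinarith
  by_cases hBA : A < B
  · nlinarith
  push Not at hA4 hBA
  set M := A / 4 with hM
  have hM4 : 4 * M ≤ A := by omega
  have hM8 : A ≤ 8 * M := by omega
  have hAJ : A * J ≤ B ^ 2 := by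
    refine Nat.le_of_mul_le_mul_right ?_ (show 0 < B by omega)
    calc A * J * B = (A * B) * J := by ring
      _ ≤ p * J := Nat.mul_le_mul_right J hAB
      _ ≤ B ^ 3 := hB
      _ = _ := by ring
  have hAle : A ≤ p := Nat.div_le_self p B
  have key := stepanov_bound hf hdeg hS hAB (by omega) (show M ≤ p by omega) ?_
  · have hp2 : p ≤ 2 * (A * B) := by nlinarith
    have h1 : A + 2 * p * B ≤ 5 * (A * B ^ 2) := by
      have : 2 * p * B ≤ 4 * (A * B ^ 2) := by
        calc 2 * p * B ≤ 2 * (2 * (A * B)) * B := by gcongr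
          _ = _ := by ring
      have h3 : A ≤ A * B ^ 2 := Nat.le_mul_of_pos_right A (by positivity)
      omega
    refine Nat.le_of_mul_le_mul_right ?_ (show 0 < A by omega)
    calc S.card * A ≤ S.card * (8 * M) := by gcongr
      _ = 8 * (S.card * M) := by ring
      _ ≤ 8 * (5 * (A * B ^ 2)) := Nat.mul_le_mul_left 8 (key.trans h1)
      _ = _ := by ring
  · have h1 : 16 * (M * (A + B + M)) ≤ 9 * (A * A) := by
      calc 16 * (M * (A + B + M)) = (4 * M) * (4 * A + 4 * B + 4 * M) := by ring
        _ ≤ A * (4 * A + 4 * A + A) := by gcongr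
        _ = _ := by ring
    have h2 : 16 * (J * (M * (A + B + M))) ≤ 9 * (A * (B * B)) := by
      calc 16 * (J * (M * (A + B + M))) = J * (16 * (M * (A + B + M))) := by ring
        _ ≤ J * (9 * (A * A)) := by gcongr
        _ = 9 * (A * (A * J)) := by ring
        _ ≤ 9 * (A * B ^ 2) := by gcongr
        _ = _ := by ring
    have h3 : 0 < A * (B * B) := by positivity
    rw [← hJ]
    omega

/-! ### Representations as differences in Heilbronn's group -/

/-- The number of representations of `x` as a difference of two elements of `A`. -/
def diffRep {G : Type*} [AddCommGroup G] [DecidableEq G] (A : Finset G) (x : G) : ℕ :=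
  (A.filter fun y => x + y ∈ A).card

theorem diffRep_zero {G : Type*} [AddCommGroup G] [DecidableEq G] (A : Finset G) :
    diffRep A 0 = A.card := by
  simp [diffRep]

theorem diffRep_le_card {G : Type*} [AddCommGroup G] [DecidableEq G] (A : Finset G) (x : G) :
    diffRep A x ≤ A.card := Finset.card_filter_le _ _

/-- The polynomial `g = ((X - 1) ^ p - X ^ p + 1) / p` has integral coefficients, and its reduction
modulo `p` satisfies the differential equation of a truncated logarithm. -/
theorem exists_truncatedLog (p : ℕ) [Fact p.Prime] :
    ∃ g : ℤ[X], (X - 1) ^ p - X ^ p + 1 = C (p : ℤ) * g ∧ g.natDegree ≤ p ∧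
      (1 - X) * derivative (g.map (Int.castRingHom (ZMod p))) = 1 - X ^ (p - 1) := by
  have hp : p ≠ 0 := (Fact.out : p.Prime).ne_zero
  have hp1 : p - 1 + 1 = p := Nat.sub_add_cancel (Fact.out : p.Prime).one_lt.le
  have hdvd : C (p : ℤ) ∣ ((X - 1) ^ p - X ^ p + 1 : ℤ[X]) := by
    rw [C_dvd_iff_dvd_coeff]
    intro i
    rw [← ZMod.intCast_zmod_eq_zero_iff_dvd]
    have h : ((X - 1) ^ p - X ^ p + 1 : ℤ[X]).map (Int.castRingHom (ZMod p)) = 0 := by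
      simp [sub_pow_char]
    have := congrArg (fun q => coeff q i) h
    rw [coeff_map] at this
    simpa using this
  obtain ⟨g, hg⟩ := hdvd
  have hpC : C (p : ℤ) ≠ 0 := by simpa using hp
  refine ⟨g, hg, ?_, ?_⟩
  · have h1 : (C (p : ℤ) * g).natDegree = g.natDegree :=
      natDegree_C_mul (by exact_mod_cast hp)
    rw [← h1, ← hg]
    have h2 : ((X - 1 : ℤ[X]) ^ p).natDegree ≤ p := by
      refine (natDegree_pow_le).trans ?_
      have : (X - 1 : ℤ[X]).natDegree ≤ 1 := by compute_degree
      nlinarith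
    refine (natDegree_add_le _ _).trans (max_le ((natDegree_sub_le _ _).trans (max_le h2 ?_)) ?_)
    · exact natDegree_X_pow_le p
    · simp
  · have hg' : derivative g = (X - 1) ^ (p - 1) - X ^ (p - 1) := by
      apply mul_left_cancel₀ hpC
      have := congrArg derivative hg
      rw [derivative_C_mul] at this
      rw [← this]
      simp [derivative_pow]
      ring
    rw [derivative_map, hg']
    have h1 : (X - 1 : (ZMod p)[X]) ^ (p - 1) * (X - 1) = X ^ p - 1 := by
      rw [← pow_succ, hp1, sub_pow_char, one_pow]
    have h2 : (X : (ZMod p)[X]) ^ (p - 1) * X = X ^ p := by rw [← pow_succ, hp1]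
    simp only [Polynomial.map_sub, Polynomial.map_pow, map_X, Polynomial.map_one]
    linear_combination -h1 + h2

section Teichmuller

variable {p : ℕ} [Fact p.Prime]

instance neZero_prime_sq : NeZero (p ^ 2) := ⟨pow_ne_zero 2 (Fact.out : p.Prime).ne_zero⟩

/-- The reduction map `ℤ/p² → ℤ/p`. -/
def redModP (p : ℕ) : ZMod (p ^ 2) →+* ZMod p := ZMod.castHom (dvd_pow_self p two_ne_zero) (ZMod p)

/-- The multiplicative section `a ↦ a ^ p` of the reduction map `ℤ/p² → ℤ/p`. -/
def teich (a : ZMod p) : ZMod (p ^ 2) := (a.val : ZMod (p ^ 2)) ^ p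

theorem teich_intCast (m : ℤ) : teich (m : ZMod p) = (m : ZMod (p ^ 2)) ^ p := by
  have h : (p : ℤ) ∣ ((m : ZMod p).val : ℤ) - m := by
    rw [← ZMod.intCast_zmod_eq_zero_iff_dvd]
    simp
  have h1 := dvd_sub_pow_of_dvd_sub h 1
  have h2 : (((p ^ 2 : ℕ) : ℤ)) ∣ ((m : ZMod p).val : ℤ) ^ p - m ^ p := by simpa using h1
  rw [← ZMod.intCast_zmod_eq_zero_iff_dvd] at h2
  push_cast at h2
  exact sub_eq_zero.1 h2

theorem exists_intCast_eq (a : ZMod p) : ∃ m : ℤ, (m : ZMod p) = a := ⟨a.val, by simp⟩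

theorem redModP_teich (a : ZMod p) : redModP p (teich a) = a := by
  rw [teich, map_pow, map_natCast, ZMod.natCast_zmod_val, ZMod.pow_card]

theorem teich_mul (a b : ZMod p) : teich (a * b) = teich a * teich b := by
  obtain ⟨m, rfl⟩ := exists_intCast_eq a
  obtain ⟨k, rfl⟩ := exists_intCast_eq b
  rw [← Int.cast_mul, teich_intCast, teich_intCast, teich_intCast, Int.cast_mul, mul_pow]

theorem teich_injective : Function.Injective (teich (p := p)) :=
  Function.LeftInverse.injective redModP_teich

theorem isUnit_of_redModP_ne_zero {x : ZMod (p ^ 2)} (hx : redModP p x ≠ 0) : IsUnit x := by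
  obtain ⟨m, rfl⟩ : ∃ m : ℕ, (m : ZMod (p ^ 2)) = x := ⟨x.val, by simp⟩
  rw [map_natCast, Ne, ZMod.natCast_eq_zero_iff] at hx
  rw [ZMod.isUnit_iff_coprime]
  exact (((Fact.out : p.Prime).coprime_iff_not_dvd.2 hx).symm).pow_right 2

theorem isUnit_teich {a : ZMod p} (ha : a ≠ 0) : IsUnit (teich a) :=
  isUnit_of_redModP_ne_zero (by rwa [redModP_teich])

theorem natCast_mul_intCast_eq_iff {m k : ℤ} :
    (p : ZMod (p ^ 2)) * m = p * k ↔ (m : ZMod p) = k := by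
  have hp : (p : ℤ) ≠ 0 := by exact_mod_cast (Fact.out : p.Prime).ne_zero
  rw [← sub_eq_zero, ← sub_eq_zero (a := (m : ZMod p)), ← Int.cast_sub,
    ZMod.intCast_zmod_eq_zero_iff_dvd,
    show (p : ZMod (p ^ 2)) * m - p * k = (((p : ℤ) * (m - k) : ℤ) : ZMod (p ^ 2)) by
      push_cast; ring, ZMod.intCast_zmod_eq_zero_iff_dvd]
  push_cast
  rw [pow_two, mul_dvd_mul_iff_left hp]

theorem heilbronnGroup_eq_image :
    heilbronnGroup p = (Finset.univ.erase (0 : ZMod p)).image teich := by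
  ext x
  simp only [heilbronnGroup, Finset.mem_image, Finset.mem_Icc, Finset.mem_erase, Finset.mem_univ,
    and_true]
  constructor
  · rintro ⟨m, ⟨hm1, hm2⟩, rfl⟩
    refine ⟨(m : ZMod p), ?_, ?_⟩
    · rw [Ne, ZMod.natCast_eq_zero_iff]
      intro h
      have := Nat.le_of_dvd hm1 h
      omega
    · exact_mod_cast teich_intCast (p := p) (m : ℤ)
  · rintro ⟨a, ha, rfl⟩
    refine ⟨a.val, ⟨?_, ?_⟩, rfl⟩
    · rw [Nat.one_le_iff_ne_zero, Ne, ZMod.val_eq_zero]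
      exact ha
    · have := ZMod.val_lt a
      omega

theorem mem_heilbronnGroup {x : ZMod (p ^ 2)} :
    x ∈ heilbronnGroup p ↔ ∃ a : ZMod p, a ≠ 0 ∧ teich a = x := by
  simp [heilbronnGroup_eq_image]

theorem teich_mem_heilbronnGroup {a : ZMod p} (ha : a ≠ 0) : teich a ∈ heilbronnGroup p :=
  mem_heilbronnGroup.2 ⟨a, ha, rfl⟩

theorem card_heilbronnGroup : (heilbronnGroup p).card = p - 1 := by
  rw [heilbronnGroup_eq_image, Finset.card_image_of_injective _ teich_injective,
    Finset.card_erase_of_mem (Finset.mem_univ _), Finset.card_univ, ZMod.card]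

theorem teich_redModP {x : ZMod (p ^ 2)} (hx : x ∈ heilbronnGroup p) :
    teich (redModP p x) = x := by
  obtain ⟨a, -, rfl⟩ := mem_heilbronnGroup.1 hx
  rw [redModP_teich]

theorem redModP_ne_zero {x : ZMod (p ^ 2)} (hx : x ∈ heilbronnGroup p) : redModP p x ≠ 0 := by
  obtain ⟨a, ha, rfl⟩ := mem_heilbronnGroup.1 hx
  rwa [redModP_teich]

theorem teich_mul_mem_iff {a : ZMod p} (ha : a ≠ 0) {x : ZMod (p ^ 2)} :
    teich a * x ∈ heilbronnGroup p ↔ x ∈ heilbronnGroup p := by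
  constructor
  · intro h
    obtain ⟨b, hb, hx⟩ := mem_heilbronnGroup.1 h
    have : teich a * x = teich a * teich (a⁻¹ * b) := by
      rw [← hx, ← teich_mul, mul_inv_cancel_left₀ ha]
    rw [(isUnit_teich ha).mul_left_cancel this]
    exact teich_mem_heilbronnGroup (mul_ne_zero (inv_ne_zero ha) hb)
  · intro h
    obtain ⟨b, hb, rfl⟩ := mem_heilbronnGroup.1 h
    rw [← teich_mul]
    exact teich_mem_heilbronnGroup (mul_ne_zero ha hb)

theorem diffRep_teich_mul {a : ZMod p} (ha : a ≠ 0) (x : ZMod (p ^ 2)) :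
    diffRep (heilbronnGroup p) (teich a * x) = diffRep (heilbronnGroup p) x := by
  symm
  refine Finset.card_bij (fun y _ => teich a * y) ?_ ?_ ?_
  · intro y hy
    simp only [Finset.mem_filter] at hy ⊢
    rw [← mul_add, teich_mul_mem_iff ha, teich_mul_mem_iff ha]
    exact hy
  · intro y _ z _ h
    exact (isUnit_teich ha).mul_left_cancel h
  · intro y hy
    obtain ⟨u, hu⟩ := (isUnit_teich ha)
    refine ⟨↑u⁻¹ * y, ?_, ?_⟩
    · have e : teich a * (↑u⁻¹ * y) = y := by rw [← hu]; simp
      simp only [Finset.mem_filter] at hy ⊢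
      rw [← teich_mul_mem_iff ha, ← teich_mul_mem_iff ha (x := x + _), mul_add, e]
      exact hy
    · rw [← hu]; simp

theorem redModP_ne_zero_of_diffRep {x : ZMod (p ^ 2)} (hx : x ≠ 0)
    (h : diffRep (heilbronnGroup p) x ≠ 0) : redModP p x ≠ 0 := by
  obtain ⟨y, hy⟩ := Finset.card_ne_zero.1 h
  obtain ⟨hy, hxy⟩ := Finset.mem_filter.1 hy
  intro h0
  apply hx
  have := teich_redModP hxy
  rw [map_add, h0, zero_add, teich_redModP hy] at this
  exact right_eq_add.1 this

/-- The level sets of the representation function of `Γ - Γ` satisfy a cubic tail bound. -/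
theorem card_levelSet_le {k : ℕ} (hk : 1 ≤ k) :
    k ^ 3 * (Finset.univ.filter fun x : ZMod (p ^ 2) =>
      x ≠ 0 ∧ k ≤ diffRep (heilbronnGroup p) x).card ≤ 16384000 * (p - 1) ^ 3 := by
  classical
  obtain ⟨g, hg, hgdeg, hgder⟩ := exists_truncatedLog p
  set f := g.map (Int.castRingHom (ZMod p)) with hf
  have hp : 2 ≤ p := (Fact.out : p.Prime).two_le
  set L := Finset.univ.filter fun x : ZMod (p ^ 2) =>
      x ≠ 0 ∧ k ≤ diffRep (heilbronnGroup p) x with hL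
  have hLinv : ∀ {a : ZMod p}, a ≠ 0 → ∀ x, teich a * x ∈ L ↔ x ∈ L := by
    intro a ha x
    simp only [hL, Finset.mem_filter, Finset.mem_univ, true_and, diffRep_teich_mul ha]
    rw [Ne, (isUnit_teich ha).mul_right_eq_zero]
  have hteich : ∀ a : ZMod p, teich a - teich (a - 1)
      = 1 - (p : ZMod (p ^ 2)) * ((f.eval a).val : ZMod (p ^ 2)) := by
    intro a
    obtain ⟨m, rfl⟩ := exists_intCast_eq a
    have h1 := congrArg (eval m) hg
    simp only [eval_add, eval_sub, eval_pow, eval_X, eval_one, eval_mul, eval_C] at h1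
    have h2 := congrArg (Int.cast : ℤ → ZMod (p ^ 2)) h1
    push_cast at h2
    have h3 : teich ((m : ZMod p) - 1) = ((m : ZMod (p ^ 2)) - 1) ^ p := by
      have := teich_intCast (p := p) (m - 1)
      push_cast at this
      exact this
    have h4 : (p : ZMod (p ^ 2)) * ((g.eval m : ℤ) : ZMod (p ^ 2))
        = p * (((f.eval (m : ZMod p)).val : ℤ) : ZMod (p ^ 2)) := by
      rw [natCast_mul_intCast_eq_iff, hf, eval_intCast_map]
      simp
    rw [h3, teich_intCast]
    push_cast at h4
    rw [← h4, ← h2]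
    ring
  set S : Finset (ZMod p) :=
    Finset.univ.filter fun a => a ≠ 0 ∧ a ≠ 1 ∧ teich a - teich (a - 1) ∈ L with hS
  set U : Finset (ZMod p) := Finset.univ.erase 0 with hU
  have hUcard : U.card = p - 1 := by
    rw [hU, Finset.card_erase_of_mem (Finset.mem_univ _), Finset.card_univ, ZMod.card]
  -- dividing a difference `x` of two elements of `Γ` by the lift of its residue puts it in the form
  -- `a ^ p - (a - 1) ^ p`
  have h1 : k * L.card ≤ (p - 1) * S.card := by
    have e1 : k * L.card ≤ (L.sigma fun x => (heilbronnGroup p).filter fun y =>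
        x + y ∈ heilbronnGroup p).card := by
      rw [Finset.card_sigma, mul_comm, ← smul_eq_mul]
      exact Finset.card_nsmul_le_sum _ _ _ fun x hx => (Finset.mem_filter.1 hx).2.2
    refine e1.trans ?_
    rw [← hUcard, ← Finset.card_product]
    refine Finset.card_le_card_of_surjOn (fun ca : ZMod p × ZMod p =>
      (⟨teich ca.1 * (teich ca.2 - teich (ca.2 - 1)), teich (ca.1 * (ca.2 - 1))⟩ :
        (_ : ZMod (p ^ 2)) × ZMod (p ^ 2))) ?_
    rintro ⟨x, y⟩ hxy
    simp only [Finset.coe_sigma, Set.mem_sigma_iff, Finset.mem_coe, Finset.mem_filter] at hxy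
    obtain ⟨hx, hy, hxy⟩ := hxy
    have hxL := (Finset.mem_filter.1 hx).2
    have hc : redModP p x ≠ 0 := redModP_ne_zero_of_diffRep hxL.1 (by omega)
    have hy0 := redModP_ne_zero hy
    have hxy0 := redModP_ne_zero hxy
    set c := redModP p x with hcdef
    have ea : c * (redModP p (x + y) / c) = redModP p (x + y) := by field_simp
    have eb : c * (redModP p (x + y) / c - 1) = redModP p y := by
      rw [mul_sub, ea, map_add]; ring
    have ex : teich c * (teich (redModP p (x + y) / c) - teich (redModP p (x + y) / c - 1))
        = x := by
      rw [mul_sub, ← teich_mul, ← teich_mul, ea, eb, teich_redModP hxy, teich_redModP hy]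
      ring
    refine ⟨(c, redModP p (x + y) / c), ?_, ?_⟩
    · simp only [Finset.coe_product, Set.mem_prod, Finset.mem_coe, hU, hS, Finset.mem_erase,
        Finset.mem_univ, and_true, Finset.mem_filter, true_and]
      refine ⟨hc, div_ne_zero hxy0 hc, ?_, ?_⟩
      · intro h
        rw [h] at eb
        simp at eb
        exact hy0 eb.symm
      · rw [← hLinv hc, ex]
        exact hx
    · simp only
      rw [ex, eb, teich_redModP hy]
  have h2 : S.card ^ 3 ≤ 4096000 * p ^ 2 * (S.image fun a => f.eval a).card ^ 2 :=
    card_preimage_truncatedLog_le hgder ((natDegree_map_le).trans hgdeg) fun x hx => by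
      obtain ⟨h0, h1, -⟩ := (Finset.mem_filter.1 hx).2
      exact ⟨h0, h1, Finset.mem_image_of_mem _ hx⟩
  set T := S.image fun a => f.eval a with hT
  -- distinct values of `f` belong to distinct orbits of `Γ`, and these orbits are free
  have h3 : (p - 1) * T.card ≤ L.card := by
    rw [← hUcard, ← Finset.card_product]
    refine Finset.card_le_card_of_injOn
      (fun ct : ZMod p × ZMod p =>
        teich ct.1 * (1 - (p : ZMod (p ^ 2)) * (ct.2.val : ZMod (p ^ 2)))) ?_ ?_
    · rintro ⟨c, t⟩ hct
      simp only [Finset.coe_product, Set.mem_prod, Finset.mem_coe, hU, Finset.mem_erase,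
        Finset.mem_univ, and_true, hT, Finset.mem_image] at hct ⊢
      obtain ⟨hc, a, ha, rfl⟩ := hct
      rw [← hteich, hLinv hc]
      exact (Finset.mem_filter.1 ha).2.2.2
    · rintro ⟨c, t⟩ hct ⟨c', t'⟩ - h
      simp only [Finset.coe_product, Set.mem_prod, Finset.mem_coe, hU, Finset.mem_erase,
        Finset.mem_univ, and_true] at hct h
      have hcc : c = c' := by
        have := congrArg (redModP p) h
        simpa [redModP_teich] using this
      subst hcc
      have := (isUnit_teich hct.1).mul_left_cancel h
      have h4 : (p : ZMod (p ^ 2)) * ((t.val : ℤ) : ZMod (p ^ 2))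
          = p * ((t'.val : ℤ) : ZMod (p ^ 2)) := by
        push_cast
        exact sub_right_injective this
      rw [natCast_mul_intCast_eq_iff] at h4
      have : t = t' := by simpa using h4
      rw [this]
  rcases Nat.eq_zero_or_pos L.card with h0 | h0
  · simp [h0]
  refine Nat.le_of_mul_le_mul_right ?_ (show 0 < L.card ^ 2 by positivity)
  have hp2 : p ≤ 2 * (p - 1) := by omega
  calc k ^ 3 * L.card * L.card ^ 2 = (k * L.card) ^ 3 := by ring
    _ ≤ ((p - 1) * S.card) ^ 3 := Nat.pow_le_pow_left h1 3
    _ = (p - 1) ^ 3 * S.card ^ 3 := by ring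
    _ ≤ (p - 1) ^ 3 * (4096000 * p ^ 2 * T.card ^ 2) := Nat.mul_le_mul_left _ h2
    _ ≤ (p - 1) ^ 3 * (4096000 * (2 * (p - 1)) ^ 2 * T.card ^ 2) := by gcongr
    _ = 16384000 * (p - 1) ^ 3 * ((p - 1) * T.card) ^ 2 := by ring
    _ ≤ 16384000 * (p - 1) ^ 3 * L.card ^ 2 := by gcongr

end Teichmuller
end

/-! ### Correlations of a finite set -/

section Correlation

/-- The real-valued indicator function of a finite set. -/
def ind {G : Type*} [DecidableEq G] (A : Finset G) (x : G) : ℝ := if x ∈ A then 1 else 0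

theorem sum_mul_ind {G : Type*} [Fintype G] [DecidableEq G] (A : Finset G) (φ : G → ℝ) :
    ∑ x, ind A x * φ x = ∑ x ∈ A, φ x := by
  simp [ind, Finset.sum_ite_mem]

variable {G : Type*} [AddCommGroup G] [Fintype G] [DecidableEq G]

theorem diffRep_eq_sum (A : Finset G) (w : G) : (diffRep A w : ℝ) = ∑ a ∈ A, ind A (a - w) := by
  have h1 : (diffRep A w : ℝ) = ∑ y ∈ A, ind A (w + y) := by
    simp [diffRep, ind, Finset.sum_boole]
  rw [h1, ← sum_mul_ind, ← sum_mul_ind A fun a => ind A (a - w), ← Equiv.sum_comp (Equiv.addLeft w)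
    (g := fun a => ind A a * ind A (a - w))]
  refine Finset.sum_congr rfl fun y _ => ?_
  simp [mul_comm]

theorem diffRep_sub (A : Finset G) (a c : G) :
    (diffRep A (a - c) : ℝ) = ∑ w, ind A (a - w) * ind A (c - w) := by
  rw [diffRep_eq_sum, ← sum_mul_ind, ← Equiv.sum_comp (Equiv.subLeft a)]
  refine Finset.sum_congr rfl fun y _ => ?_
  simp

theorem sum_sum_sub (A : Finset G) (φ : G → ℝ) :
    ∑ a ∈ A, ∑ b ∈ A, φ (a - b) = ∑ x, (diffRep A x : ℝ) * φ x := by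
  have h : ∀ a ∈ A, ∑ b ∈ A, φ (a - b) = ∑ x, ind A (a - x) * φ x := by
    intro a _
    rw [← sum_mul_ind, ← Equiv.sum_comp (Equiv.subLeft a)]
    refine Finset.sum_congr rfl fun y _ => ?_
    simp
  rw [Finset.sum_congr rfl h, Finset.sum_comm]
  refine Finset.sum_congr rfl fun x _ => ?_
  rw [← Finset.sum_mul, diffRep_eq_sum]

theorem diffRep_neg (A : Finset G) (x : G) : diffRep A (-x) = diffRep A x := by
  have h : (diffRep A (-x) : ℝ) = diffRep A x := by
    have h1 := diffRep_sub A 0 x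
    have h2 := diffRep_sub A x 0
    rw [zero_sub] at h1
    rw [sub_zero] at h2
    rw [h1, h2]
    exact Finset.sum_congr rfl fun w _ => mul_comm _ _
  exact_mod_cast h

theorem addEnergy_eq_sum_diffRep_sq (A : Finset G) :
    (Finset.addEnergy A A : ℝ) = ∑ x, (diffRep A x : ℝ) ^ 2 := by
  have h1 : (Finset.addEnergy A A : ℝ) = ∑ a ∈ A, ∑ b ∈ A, (diffRep A (a - b) : ℝ) := by
    have : Finset.addEnergy A A = ∑ a ∈ A, ∑ b ∈ A, diffRep A (a - b) := by
      simp only [diffRep]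
      rw [Finset.addEnergy_eq_card_filter]
      rw [← Finset.sum_product', ← Finset.card_sigma]
      refine Finset.card_bij (fun q _ => ⟨(q.1.1, q.2.1), q.1.2⟩) ?_ ?_ ?_
      · rintro ⟨⟨a, b⟩, c, d⟩ h
        simp only [Finset.mem_filter, Finset.mem_product, Finset.mem_sigma] at h ⊢
        obtain ⟨⟨⟨ha, hb⟩, hc, hd⟩, he⟩ := h
        refine ⟨⟨ha, hc⟩, hb, ?_⟩
        have : a - c + b = d := by rw [sub_add_eq_add_sub, he]; abel
        rwa [this]
      · rintro ⟨⟨a, b⟩, c, d⟩ h ⟨⟨a', b'⟩, c', d'⟩ h' he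
        simp only [Finset.mem_filter] at h h'
        simp only [Sigma.mk.injEq, Prod.mk.injEq, heq_eq_eq] at he
        obtain ⟨⟨rfl, rfl⟩, rfl⟩ := he
        have := h.2.symm.trans h'.2
        simpa using this
      · rintro ⟨⟨a, c⟩, b⟩ h
        simp only [Finset.mem_filter, Finset.mem_product, Finset.mem_sigma] at h
        refine ⟨((a, b), (c, a - c + b)), ?_, rfl⟩
        simp only [Finset.mem_filter, Finset.mem_product]
        exact ⟨⟨⟨h.1.1, h.2.1⟩, h.1.2, h.2.2⟩, by abel⟩
    rw [this]
    push_cast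
    rfl
  rw [h1, sum_sum_sub A fun x => (diffRep A x : ℝ)]
  exact Finset.sum_congr rfl fun x _ => (sq _).symm

theorem sum_diffRep (A : Finset G) : ∑ x, (diffRep A x : ℝ) = (A.card : ℝ) ^ 2 := by
  have := sum_sum_sub A fun _ => (1 : ℝ)
  simp only [mul_one] at this
  rw [← this]
  simp
  ring

/-- The kernel `(a, c) ↦ diffRep A (a - c)` is positive semidefinite, so that the constant function,
an eigenfunction of the kernel `g (a - b)` with eigenvalue `μ`, bounds the triple correlation from
below. -/
theorem sq_mul_energy_le_triple (A : Finset G) {g : G → ℝ} (hg : ∀ x, g (-x) = g x) {μ : ℝ}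
    (hμ : ∀ a ∈ A, ∑ b ∈ A, g (a - b) = μ) :
    μ ^ 2 * ∑ w, (diffRep A w : ℝ) ^ 2 ≤
      A.card * ∑ a ∈ A, ∑ b ∈ A, ∑ c ∈ A, g (a - b) * g (b - c) * diffRep A (a - c) := by
  have h1 : ∑ a ∈ A, ∑ b ∈ A, ∑ c ∈ A, g (a - b) * g (b - c) * diffRep A (a - c)
      = ∑ w, ∑ b ∈ A, (∑ a ∈ A, ind A (a - w) * g (a - b)) ^ 2 := by
    calc _ = ∑ a ∈ A, ∑ b ∈ A, ∑ c ∈ A, ∑ w,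
          (ind A (a - w) * g (a - b)) * (ind A (c - w) * g (c - b)) := by
          refine Finset.sum_congr rfl fun a _ => Finset.sum_congr rfl fun b _ =>
            Finset.sum_congr rfl fun c _ => ?_
          rw [diffRep_sub, Finset.mul_sum]
          refine Finset.sum_congr rfl fun w _ => ?_
          rw [← hg (b - c), neg_sub]
          ring
      _ = ∑ b ∈ A, ∑ a ∈ A, ∑ c ∈ A, ∑ w,
          (ind A (a - w) * g (a - b)) * (ind A (c - w) * g (c - b)) := Finset.sum_comm
      _ = ∑ b ∈ A, ∑ w, (∑ a ∈ A, ind A (a - w) * g (a - b)) ^ 2 := by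
          refine Finset.sum_congr rfl fun b _ => ?_
          have : ∀ w, (∑ a ∈ A, ind A (a - w) * g (a - b)) ^ 2 = ∑ a ∈ A, ∑ c ∈ A,
              (ind A (a - w) * g (a - b)) * (ind A (c - w) * g (c - b)) := fun w => by
            rw [sq, Finset.sum_mul_sum]
          simp only [this]
          rw [Finset.sum_comm (s := Finset.univ)]
          refine Finset.sum_congr rfl fun a _ => ?_
          rw [Finset.sum_comm (s := Finset.univ)]
      _ = _ := Finset.sum_comm
  rw [h1, Finset.mul_sum, Finset.mul_sum]
  refine Finset.sum_le_sum fun w _ => ?_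
  refine le_trans (le_of_eq ?_) (sq_sum_le_card_mul_sum_sq (s := A)
    (f := fun b => ∑ a ∈ A, ind A (a - w) * g (a - b)))
  rw [Finset.sum_comm, ← mul_pow]
  congr 1
  rw [diffRep_eq_sum, Finset.mul_sum]
  refine Finset.sum_congr rfl fun a ha => ?_
  rw [← Finset.mul_sum, hμ a ha, mul_comm]

/-- Cauchy–Schwarz for a sum over triples of `A` of a function of two consecutive differences: the
number of triples with given differences has the third energy of `A` as its second moment. -/
theorem sq_triple_le_energy_three (A : Finset G) (F : G → G → ℝ) :
    (∑ a ∈ A, ∑ b ∈ A, ∑ c ∈ A, F (a - b) (b - c)) ^ 2 ≤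
      (∑ v, (diffRep A v : ℝ) ^ 3) * ∑ x, ∑ y, F x y ^ 2 := by
  set T : G × G → ℝ := fun z => ∑ b ∈ A, ind A (b + z.1) * ind A (b - z.2) with hT
  have h1 : ∑ a ∈ A, ∑ b ∈ A, ∑ c ∈ A, F (a - b) (b - c) = ∑ z : G × G, T z * F z.1 z.2 := by
    simp only [hT, Finset.sum_mul]
    rw [Finset.sum_comm, Finset.sum_comm (s := Finset.univ)]
    refine Finset.sum_congr rfl fun b _ => ?_
    rw [Fintype.sum_prod_type, ← sum_mul_ind, ← Equiv.sum_comp (Equiv.addLeft b)]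
    refine Finset.sum_congr rfl fun x _ => ?_
    rw [← sum_mul_ind, ← Equiv.sum_comp (Equiv.subLeft b), Finset.mul_sum]
    refine Finset.sum_congr rfl fun y _ => ?_
    simp
    ring
  have hrep : ∀ b b' : G, (diffRep A (b - b') : ℝ) = ∑ x, ind A (b + x) * ind A (b' + x) := by
    intro b b'
    rw [diffRep_sub, ← Equiv.sum_comp (Equiv.neg G)]
    simp
  have h2 : ∑ z, T z ^ 2 = ∑ v, (diffRep A v : ℝ) ^ 3 := by
    have h3 : ∑ v, (diffRep A v : ℝ) ^ 3 = ∑ b ∈ A, ∑ b' ∈ A, (diffRep A (b - b') : ℝ) ^ 2 := by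
      rw [sum_sum_sub A fun x => (diffRep A x : ℝ) ^ 2]
      exact Finset.sum_congr rfl fun v _ => by ring
    rw [h3]
    simp only [hT, sq, Finset.sum_mul_sum]
    rw [Finset.sum_comm]
    refine Finset.sum_congr rfl fun b _ => ?_
    rw [Finset.sum_comm]
    refine Finset.sum_congr rfl fun b' _ => ?_
    nth_rewrite 1 [hrep b b']
    rw [diffRep_sub, Finset.sum_mul_sum, Fintype.sum_prod_type]
    refine Finset.sum_congr rfl fun x _ => Finset.sum_congr rfl fun y _ => ?_
    ring
  rw [h1, ← h2, ← Fintype.sum_prod_type' (f := fun x y => F x y ^ 2)]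
  exact Finset.sum_mul_sq_le_sq_mul_sq _ _ _

end Correlation

/-! ### Sums of two elements with invariant weights -/

/-- A weighted count of the solutions of `x + y = z`, where the weight of `x` and `y` is invariant
under a set `Γ` of units which injects into the residue field. -/
theorem sq_weighted_count_le {R F : Type*} [CommRing R] [Fintype R] [DecidableEq R] [Field F]
    [Fintype F] [DecidableEq F] (π : R →+* F) (hπ : ∀ x, π x ≠ 0 → IsUnit x) {Γ : Finset R}
    (hΓ : Set.InjOn π Γ) (hΓ0 : ∀ γ ∈ Γ, π γ ≠ 0) (hne : Γ.Nonempty)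
    {u : R → ℝ} (v : R → ℝ) (hu0 : ∀ x, 0 ≤ u x) (hu : ∀ γ ∈ Γ, ∀ x, u (γ * x) = u x)
    (hunit : ∀ x, π x = 0 → u x = 0) :
    (∑ x, ∑ y, u x * u y * v (x + y)) ^ 2 ≤ Fintype.card F * (∑ z, v z ^ 2) *
      ((∑ x, u x ^ 2) ^ 2 + (∑ x, u x) ^ 4 / (Γ.card : ℝ) ^ 3) := by
  have hn : (0 : ℝ) < Γ.card := by exact_mod_cast hne.card_pos
  set n : ℝ := (Γ.card : ℝ) with hndef
  set σ := ∑ x, u x with hσ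
  have hσ0 : 0 ≤ σ := Finset.sum_nonneg fun x _ => hu0 x
  -- the sum of `u` over a fibre of `π`
  set U : F → ℝ := fun a => ∑ x, if π x = a then u x else 0 with hU
  have hU0 : ∀ a, 0 ≤ U a := fun a => Finset.sum_nonneg fun x _ => by
    split_ifs
    · exact hu0 x
    · exact le_rfl
  have hUsum : ∑ a, U a = σ := by
    simp only [hU]
    rw [Finset.sum_comm]
    simp [hσ]
  have hUinv : ∀ γ ∈ Γ, ∀ a, U (π γ * a) = U a := by
    intro γ hγ a
    obtain ⟨w, hw⟩ := hπ γ (hΓ0 γ hγ)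
    simp only [hU]
    rw [← Equiv.sum_comp (Units.mulLeft w)]
    refine Finset.sum_congr rfl fun x _ => ?_
    simp only [Units.mulLeft_apply, hw, hu γ hγ, map_mul]
    congr 1
    simp [hΓ0 γ hγ]
  have hUle : ∀ a, n * U a ≤ σ := by
    intro a
    by_cases ha : a = 0
    · have : U a = 0 := Finset.sum_eq_zero fun x _ => by
        split_ifs with h
        · exact hunit x (h.trans ha)
        · rfl
      rw [this]; simpa using hσ0
    calc n * U a = ∑ γ ∈ Γ, U (π γ * a) := by
          rw [Finset.sum_congr rfl fun γ hγ => hUinv γ hγ a]; simp [hndef]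
      _ = ∑ b ∈ Γ.image (fun γ => π γ * a), U b := by
          rw [Finset.sum_image fun x hx y hy h => hΓ hx hy (mul_right_cancel₀ ha h)]
      _ ≤ ∑ b, U b := Finset.sum_le_univ_sum_of_nonneg hU0
      _ = σ := hUsum
  -- the correlation of `u` at the shift `s`; it is needed for `s` in the kernel of `π` only
  set M : R → ℝ := fun s => ∑ y, u y * u (y + s) with hM
  have hM0 : ∀ s, 0 ≤ M s := fun s => Finset.sum_nonneg fun y _ => mul_nonneg (hu0 _) (hu0 _)
  have hMinv : ∀ γ ∈ Γ, ∀ s, M (γ * s) = M s := by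
    intro γ hγ s
    obtain ⟨w, hw⟩ := hπ γ (hΓ0 γ hγ)
    simp only [hM]
    rw [← Equiv.sum_comp (Units.mulLeft w)]
    refine Finset.sum_congr rfl fun x _ => ?_
    simp only [Units.mulLeft_apply, hw, ← mul_add, hu γ hγ]
  set K := Finset.univ.filter fun s : R => π s = 0 with hK
  have hKsum : n * ∑ s ∈ K, M s ≤ σ ^ 2 := by
    have : ∑ s ∈ K, M s = ∑ y, u y * U (π y) := by
      simp only [hM, hU]
      rw [Finset.sum_comm]
      refine Finset.sum_congr rfl fun y _ => ?_
      rw [← Finset.mul_sum, hK, Finset.sum_filter, ← Equiv.sum_comp (Equiv.addLeft y)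
        (g := fun x => if π x = π y then u x else 0)]
      simp
    rw [this, Finset.mul_sum, sq]
    nth_rewrite 1 [hσ]
    rw [Finset.sum_mul]
    refine Finset.sum_le_sum fun y _ => ?_
    rw [mul_left_comm]
    exact mul_le_mul_of_nonneg_left (hUle _) (hu0 y)
  have hMle : ∀ s ∈ K, s ≠ 0 → n ^ 2 * M s ≤ σ ^ 2 := by
    intro s hs hs0
    refine le_trans ?_ hKsum
    rw [sq, mul_assoc]
    refine mul_le_mul_of_nonneg_left ?_ hn.le
    calc n * M s = ∑ γ ∈ Γ, M (γ * s) := by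
          rw [Finset.sum_congr rfl fun γ hγ => hMinv γ hγ s]; simp [hndef]
      _ = ∑ t ∈ Γ.image (fun γ => γ * s), M t := by
          rw [Finset.sum_image]
          intro x hx y hy h
          by_contra hxy
          have hsub : π (x - y) ≠ 0 := by
            rw [map_sub, sub_ne_zero]
            exact fun h => hxy (hΓ hx hy h)
          apply hs0
          rw [← (hπ _ hsub).mul_right_eq_zero, sub_mul, sub_eq_zero]
          exact h
      _ ≤ ∑ t ∈ K, M t := by
          refine Finset.sum_le_sum_of_subset_of_nonneg ?_ fun t _ _ => hM0 t
          intro t ht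
          obtain ⟨γ, -, rfl⟩ := Finset.mem_image.1 ht
          simp only [hK, Finset.mem_filter, Finset.mem_univ, true_and] at hs ⊢
          rw [map_mul, hs, mul_zero]
  have hQ : ∑ s ∈ K, M s ^ 2 ≤ (∑ x, u x ^ 2) ^ 2 + σ ^ 4 / n ^ 3 := by
    have h0K : (0 : R) ∈ K := by simp [hK]
    rw [← Finset.add_sum_erase _ _ h0K]
    refine add_le_add (le_of_eq ?_) ?_
    · simp only [hM, add_zero, sq]
    · rw [le_div_iff₀ (by positivity)]
      calc (∑ s ∈ K.erase 0, M s ^ 2) * n ^ 3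
          = n * ∑ s ∈ K.erase 0, (n ^ 2 * M s) * M s := by
            rw [Finset.mul_sum, Finset.sum_mul]
            exact Finset.sum_congr rfl fun s _ => by ring
        _ ≤ n * ∑ s ∈ K.erase 0, σ ^ 2 * M s := by
            refine mul_le_mul_of_nonneg_left (Finset.sum_le_sum fun s hs => ?_) hn.le
            exact mul_le_mul_of_nonneg_right
              (hMle s (Finset.mem_of_mem_erase hs) (Finset.ne_of_mem_erase hs)) (hM0 s)
        _ ≤ n * ∑ s ∈ K, σ ^ 2 * M s := by
            refine mul_le_mul_of_nonneg_left (Finset.sum_le_sum_of_subset_of_nonneg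
              (Finset.erase_subset _ _) fun s _ _ => mul_nonneg (sq_nonneg _) (hM0 s)) hn.le
        _ = σ ^ 2 * (n * ∑ s ∈ K, M s) := by rw [← Finset.mul_sum]; ring
        _ ≤ σ ^ 2 * σ ^ 2 := mul_le_mul_of_nonneg_left hKsum (sq_nonneg _)
        _ = σ ^ 4 := by ring
  -- the part of the convolution of `u` with itself at `z` that comes from one fibre of `π`
  set H : F × R → ℝ := fun q => ∑ x, if π x = q.1 then u x * u (q.2 - x) else 0 with hH
  have hW : ∑ x, ∑ y, u x * u y * v (x + y) = ∑ q : F × R, v q.2 * H q := by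
    have e1 : ∀ x, ∑ y, u x * u y * v (x + y) = ∑ z, v z * (u x * u (z - x)) := by
      intro x
      rw [← Equiv.sum_comp (Equiv.addLeft x) (g := fun z => v z * (u x * u (z - x)))]
      refine Finset.sum_congr rfl fun y _ => ?_
      simp
      ring
    rw [Finset.sum_congr rfl fun x _ => e1 x, Finset.sum_comm, Fintype.sum_prod_type,
      Finset.sum_comm (s := (Finset.univ : Finset F))]
    refine Finset.sum_congr rfl fun z _ => ?_
    rw [← Finset.mul_sum]
    change _ = ∑ a, v z * H (a, z)
    rw [← Finset.mul_sum]
    congr 1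
    simp only [hH]
    rw [Finset.sum_comm]
    simp
  have hH2 : ∑ q, H q ^ 2 = ∑ s ∈ K, M s ^ 2 := by
    have e1 : ∀ q : F × R, H q ^ 2 = ∑ x, ∑ x', if π x = q.1 then
        (if π x' = q.1 then (u x * u x') * (u (q.2 - x) * u (q.2 - x')) else 0) else 0 := by
      intro q
      simp only [hH]
      rw [sq, Finset.sum_mul_sum]
      refine Finset.sum_congr rfl fun x _ => Finset.sum_congr rfl fun x' _ => ?_
      split_ifs <;> ring
    have e2 : ∀ x x', ∑ z, u (z - x) * u (z - x') = M (x - x') := by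
      intro x x'
      rw [← Equiv.sum_comp (Equiv.addRight x)]
      refine Finset.sum_congr rfl fun y _ => ?_
      simp [add_sub_assoc]
    calc ∑ q, H q ^ 2 = ∑ q : F × R, ∑ x, ∑ x', if π x = q.1 then
        (if π x' = q.1 then (u x * u x') * (u (q.2 - x) * u (q.2 - x')) else 0) else 0 :=
          Finset.sum_congr rfl fun q _ => e1 q
      _ = ∑ x, ∑ x', if π x' = π x then u x * u x' * M (x - x') else 0 := by
          rw [Finset.sum_comm]
          refine Finset.sum_congr rfl fun x _ => ?_
          rw [Finset.sum_comm]
          refine Finset.sum_congr rfl fun x' _ => ?_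
          rw [Fintype.sum_prod_type, Finset.sum_comm]
          simp only [Finset.sum_ite_eq, Finset.mem_univ, if_true]
          split_ifs with h
          · rw [← Finset.mul_sum, e2]
          · simp
      _ = ∑ x', ∑ s, if π s = 0 then (u x' * u (x' + s)) * M s else 0 := by
          rw [Finset.sum_comm]
          refine Finset.sum_congr rfl fun x' _ => ?_
          rw [← Equiv.sum_comp (Equiv.addLeft x')]
          refine Finset.sum_congr rfl fun s _ => ?_
          simp [mul_comm]
      _ = ∑ s ∈ K, M s ^ 2 := by
          rw [Finset.sum_comm, hK, Finset.sum_filter]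
          refine Finset.sum_congr rfl fun s _ => ?_
          split_ifs
          · rw [← Finset.sum_mul, sq]
          · simp
  rw [hW]
  refine (Finset.sum_mul_sq_le_sq_mul_sq _ _ _).trans ?_
  rw [hH2]
  refine mul_le_mul (le_of_eq ?_) hQ (Finset.sum_nonneg fun s _ => sq_nonneg _) (by positivity)
  rw [Fintype.sum_prod_type]
  simp

/-! ### Moments from a cubic tail bound -/

section LayerCake

variable {ι : Type*} {S : Finset ι} {r : ι → ℕ} {D : ℝ}

/-- Summation by levels. -/
theorem layerCake {N : ℕ} (hN : ∀ x ∈ S, r x ≤ N) (w : ℕ → ℝ) :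
    ∑ x ∈ S, ∑ k ∈ Finset.Icc 1 (r x), w k
      = ∑ k ∈ Finset.Icc 1 N, w k * (S.filter fun x => k ≤ r x).card := by
  have h : ∀ x ∈ S, ∑ k ∈ Finset.Icc 1 (r x), w k
      = ∑ k ∈ Finset.Icc 1 N, if k ≤ r x then w k else 0 := by
    intro x hx
    rw [← Finset.sum_filter]
    refine Finset.sum_congr ?_ fun _ _ => rfl
    ext k
    have := hN x hx
    simp only [Finset.mem_Icc, Finset.mem_filter]
    omega
  rw [Finset.sum_congr rfl h, Finset.sum_comm]
  refine Finset.sum_congr rfl fun k _ => ?_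
  rw [← Finset.sum_filter, Finset.sum_const, nsmul_eq_mul, mul_comm]

theorem sum_pow_four_le (hD : ∀ k : ℕ, 1 ≤ k → (k : ℝ) ^ 3 * (S.filter fun x => k ≤ r x).card ≤ D)
    {τ : ℝ} (hτ : 0 ≤ τ) (hS : ∀ x ∈ S, (r x : ℝ) ≤ τ) :
    ∑ x ∈ S, (r x : ℝ) ^ 4 ≤ 4 * D * τ := by
  have hpow : ∀ m : ℕ, (m : ℝ) ^ 4 ≤ ∑ k ∈ Finset.Icc 1 m, 4 * (k : ℝ) ^ 3 := by
    intro m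
    induction m with
    | zero => simp
    | succ m ih =>
      rw [Finset.sum_Icc_succ_top (by omega)]
      push_cast
      nlinarith [sq_nonneg ((m : ℝ)), (Nat.cast_nonneg m : (0 : ℝ) ≤ m)]
  have hD0 : 0 ≤ D := le_trans (by positivity) (hD 1 le_rfl)
  calc ∑ x ∈ S, (r x : ℝ) ^ 4 ≤ ∑ x ∈ S, ∑ k ∈ Finset.Icc 1 (r x), 4 * (k : ℝ) ^ 3 :=
        Finset.sum_le_sum fun x _ => hpow _
    _ = ∑ k ∈ Finset.Icc 1 ⌊τ⌋₊, 4 * (k : ℝ) ^ 3 * (S.filter fun x => k ≤ r x).card :=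
        layerCake (fun x hx => Nat.le_floor (hS x hx)) _
    _ ≤ ∑ k ∈ Finset.Icc 1 ⌊τ⌋₊, 4 * D := by
        refine Finset.sum_le_sum fun k hk => ?_
        rw [mul_assoc]
        exact mul_le_mul_of_nonneg_left (hD k (Finset.mem_Icc.1 hk).1) (by norm_num)
    _ = 4 * D * ⌊τ⌋₊ := by simp; ring
    _ ≤ 4 * D * τ := mul_le_mul_of_nonneg_left (Nat.floor_le hτ) (by positivity)

theorem sum_pow_three_le
    (hD : ∀ k : ℕ, 1 ≤ k → (k : ℝ) ^ 3 * (S.filter fun x => k ≤ r x).card ≤ D)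
    {N : ℕ} (hN : ∀ x ∈ S, r x ≤ N) :
    ∑ x ∈ S, (r x : ℝ) ^ 3 ≤ 3 * D * (1 + Real.log N) := by
  have hpow : ∀ m : ℕ, (m : ℝ) ^ 3 ≤ ∑ k ∈ Finset.Icc 1 m, 3 * (k : ℝ) ^ 2 := by
    intro m
    induction m with
    | zero => simp
    | succ m ih =>
      rw [Finset.sum_Icc_succ_top (by omega)]
      push_cast
      nlinarith [(Nat.cast_nonneg m : (0 : ℝ) ≤ m)]
  have hD0 : 0 ≤ D := le_trans (by positivity) (hD 1 le_rfl)
  have hharm : ∑ k ∈ Finset.Icc 1 N, ((k : ℝ))⁻¹ ≤ 1 + Real.log N := by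
    have := harmonic_le_one_add_log N
    rw [harmonic_eq_sum_Icc] at this
    push_cast at this
    exact this
  calc ∑ x ∈ S, (r x : ℝ) ^ 3 ≤ ∑ x ∈ S, ∑ k ∈ Finset.Icc 1 (r x), 3 * (k : ℝ) ^ 2 :=
        Finset.sum_le_sum fun x _ => hpow _
    _ = ∑ k ∈ Finset.Icc 1 N, 3 * (k : ℝ) ^ 2 * (S.filter fun x => k ≤ r x).card :=
        layerCake hN _
    _ ≤ ∑ k ∈ Finset.Icc 1 N, 3 * D * (k : ℝ)⁻¹ := by
        refine Finset.sum_le_sum fun k hk => ?_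
        have hk1 := (Finset.mem_Icc.1 hk).1
        have hk0 : (0 : ℝ) < k := by exact_mod_cast hk1
        rw [← div_eq_mul_inv, le_div_iff₀ hk0]
        nlinarith [hD k hk1]
    _ ≤ _ := by
        rw [← Finset.mul_sum]
        exact mul_le_mul_of_nonneg_left hharm (by positivity)

theorem sum_sq_le_of_lt
    (hD : ∀ k : ℕ, 1 ≤ k → (k : ℝ) ^ 3 * (S.filter fun x => k ≤ r x).card ≤ D)
    {τ : ℝ} (hτ : 0 < τ) (hS : ∀ x ∈ S, τ < r x) :
    ∑ x ∈ S, (r x : ℝ) ^ 2 ≤ 4 * D / τ := by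
  have hD0 : 0 ≤ D := le_trans (by positivity) (hD 1 le_rfl)
  set m := ⌊τ⌋₊ + 1 with hm
  have hτm : τ < m := by simpa [hm] using Nat.lt_floor_add_one τ
  have hm0 : (0 : ℝ) < m := hτ.trans hτm
  have hm1 : (1 : ℝ) ≤ m := by exact_mod_cast (by omega : 1 ≤ m)
  have hSm : ∀ x ∈ S, m ≤ r x := fun x hx => (Nat.floor_lt hτ.le).2 (hS x hx)
  set N := m + S.sup r with hN
  have hNr : ∀ x ∈ S, r x ≤ N := fun x hx => (Finset.le_sup hx).trans (by omega)
  have hpow : ∀ m : ℕ, (m : ℝ) ^ 2 ≤ ∑ k ∈ Finset.Icc 1 m, 2 * (k : ℝ) := by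
    intro m
    induction m with
    | zero => simp
    | succ m ih =>
      rw [Finset.sum_Icc_succ_top (by omega)]
      push_cast
      nlinarith [(Nat.cast_nonneg m : (0 : ℝ) ≤ m)]
  have hsmall : ∀ k ∈ Finset.Ioc 0 m,
      2 * (k : ℝ) * (S.filter fun x => k ≤ r x).card ≤ 2 * D / (m : ℝ) ^ 2 := by
    intro k hk
    have hk : (k : ℝ) ≤ m := by exact_mod_cast (Finset.mem_Ioc.1 hk).2
    have h1 : ((S.filter fun x => k ≤ r x).card : ℝ) ≤ (S.filter fun x => m ≤ r x).card := by
      rw [Finset.filter_true_of_mem hSm]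
      exact_mod_cast Finset.card_filter_le _ _
    have h2 := hD m (by omega)
    rw [le_div_iff₀ (by positivity)]
    calc 2 * (k : ℝ) * (S.filter fun x => k ≤ r x).card * (m : ℝ) ^ 2
        ≤ 2 * (m : ℝ) * (S.filter fun x => m ≤ r x).card * (m : ℝ) ^ 2 := by gcongr
      _ = 2 * ((m : ℝ) ^ 3 * (S.filter fun x => m ≤ r x).card) := by ring
      _ ≤ 2 * D := by linarith
  have hlarge : ∀ k ∈ Finset.Ioc m N,
      2 * (k : ℝ) * (S.filter fun x => k ≤ r x).card ≤ 2 * D * ((k : ℝ) ^ 2)⁻¹ := by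
    intro k hk
    have hk1 : 1 ≤ k := by have := (Finset.mem_Ioc.1 hk).1; omega
    have hk0 : (0 : ℝ) < k := by exact_mod_cast hk1
    rw [← div_eq_mul_inv, le_div_iff₀ (by positivity)]
    nlinarith [hD k hk1]
  calc ∑ x ∈ S, (r x : ℝ) ^ 2 ≤ ∑ x ∈ S, ∑ k ∈ Finset.Icc 1 (r x), 2 * (k : ℝ) :=
        Finset.sum_le_sum fun x _ => hpow _
    _ = ∑ k ∈ Finset.Icc 1 N, 2 * (k : ℝ) * (S.filter fun x => k ≤ r x).card := layerCake hNr _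
    _ = ∑ k ∈ Finset.Ioc 0 m, 2 * (k : ℝ) * (S.filter fun x => k ≤ r x).card
        + ∑ k ∈ Finset.Ioc m N, 2 * (k : ℝ) * (S.filter fun x => k ≤ r x).card := by
        rw [Finset.sum_Ioc_consecutive _ (Nat.zero_le _) (by omega)]
        rfl
    _ ≤ ∑ k ∈ Finset.Ioc 0 m, 2 * D / (m : ℝ) ^ 2
        + ∑ k ∈ Finset.Ioc m N, 2 * D * ((k : ℝ) ^ 2)⁻¹ :=
        add_le_add (Finset.sum_le_sum hsmall) (Finset.sum_le_sum hlarge)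
    _ ≤ 2 * D / m + 2 * D / m := by
        refine add_le_add (le_of_eq ?_) ?_
        · simp
          field_simp
        · rw [← Finset.mul_sum, div_eq_mul_inv]
          refine mul_le_mul_of_nonneg_left ?_ (by positivity)
          refine (sum_Ioc_inv_sq_le_sub (by omega) (by omega)).trans ?_
          have : (0 : ℝ) ≤ (N : ℝ)⁻¹ := by positivity
          linarith
    _ = 4 * D / m := by ring
    _ ≤ 4 * D / τ := by gcongr

end LayerCake

/-! ### Moments of the representation function -/

section Moments

variable {p : ℕ} [Fact p.Prime] {K : ℝ}

/-- The number of nonzero `x` with at least `k` representations as a difference of two elements of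
`Γ` is at most `K |Γ|³ / k³`. -/
def HasCubicTail (p : ℕ) [Fact p.Prime] (K : ℝ) : Prop :=
  ∀ k : ℕ, 1 ≤ k → (k : ℝ) ^ 3 * (((Finset.univ.erase (0 : ZMod (p ^ 2))).filter
    fun x => k ≤ diffRep (heilbronnGroup p) x).card : ℝ) ≤ K * ((heilbronnGroup p).card : ℝ) ^ 3

theorem hasCubicTail_heilbronnGroup (p : ℕ) [Fact p.Prime] : HasCubicTail p 16384000 := by
  intro k hk
  rw [card_heilbronnGroup]
  have h := card_levelSet_le (p := p) hk
  have e : (Finset.univ.erase (0 : ZMod (p ^ 2))).filter (fun x => k ≤ diffRep (heilbronnGroup p) x)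
      = Finset.univ.filter fun x : ZMod (p ^ 2) =>
        x ≠ 0 ∧ k ≤ diffRep (heilbronnGroup p) x := by
    ext x; simp
  rw [e]
  exact_mod_cast h

theorem HasCubicTail.mono {S : Finset (ZMod (p ^ 2))} (h : HasCubicTail p K)
    (hS : (0 : ZMod (p ^ 2)) ∉ S)
    (k : ℕ) (hk : 1 ≤ k) :
    (k : ℝ) ^ 3 * ((S.filter fun x => k ≤ diffRep (heilbronnGroup p) x).card : ℝ)
      ≤ K * ((heilbronnGroup p).card : ℝ) ^ 3 := by
  refine le_trans (mul_le_mul_of_nonneg_left ?_ (by positivity)) (h k hk)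
  exact_mod_cast Finset.card_le_card (Finset.filter_subset_filter _ fun x hx =>
    Finset.mem_erase.2 ⟨fun h0 => hS (by rwa [h0] at hx), Finset.mem_univ x⟩)

theorem HasCubicTail.sum_sq_le (h : HasCubicTail p K) {τ : ℝ} (hτ : 0 < τ) :
    ∑ x with τ < (diffRep (heilbronnGroup p) x : ℝ), (diffRep (heilbronnGroup p) x : ℝ) ^ 2 ≤
      ((heilbronnGroup p).card : ℝ) ^ 2 + 4 * (K * ((heilbronnGroup p).card : ℝ) ^ 3) / τ := by
  set S := Finset.univ.filter fun x : ZMod (p ^ 2) => τ < (diffRep (heilbronnGroup p) x : ℝ) with hS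
  have h1 : ∑ x ∈ S.erase 0, (diffRep (heilbronnGroup p) x : ℝ) ^ 2
      ≤ 4 * (K * ((heilbronnGroup p).card : ℝ) ^ 3) / τ :=
    sum_sq_le_of_lt (h.mono (by simp)) hτ fun x hx =>
      (Finset.mem_filter.1 (Finset.mem_of_mem_erase hx)).2
  have h2 : ∑ x ∈ S, (diffRep (heilbronnGroup p) x : ℝ) ^ 2
      ≤ ∑ x ∈ insert 0 (S.erase 0), (diffRep (heilbronnGroup p) x : ℝ) ^ 2 :=
    Finset.sum_le_sum_of_subset_of_nonneg (Finset.insert_erase_subset 0 S)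
      fun x _ _ => sq_nonneg _
  rw [Finset.sum_insert (by simp), diffRep_zero] at h2
  linarith

theorem HasCubicTail.sum_pow_four_le (h : HasCubicTail p K) {τ : ℝ} (hτ : 0 ≤ τ)
    (hτn : τ < (heilbronnGroup p).card) :
    ∑ x with (diffRep (heilbronnGroup p) x : ℝ) ≤ τ, (diffRep (heilbronnGroup p) x : ℝ) ^ 4 ≤
      4 * (K * ((heilbronnGroup p).card : ℝ) ^ 3) * τ := by
  refine _root_.sum_pow_four_le (h.mono ?_) hτ fun x hx => (Finset.mem_filter.1 hx).2
  simp only [Finset.mem_filter, diffRep_zero, not_and, not_le]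
  exact fun _ => hτn

theorem HasCubicTail.sum_pow_three_le (h : HasCubicTail p K) :
    ∑ x, (diffRep (heilbronnGroup p) x : ℝ) ^ 3 ≤ ((heilbronnGroup p).card : ℝ) ^ 3 +
      3 * (K * ((heilbronnGroup p).card : ℝ) ^ 3) * (1 + Real.log (heilbronnGroup p).card) := by
  rw [← Finset.add_sum_erase _ _ (Finset.mem_univ (0 : ZMod (p ^ 2))), diffRep_zero]
  exact add_le_add le_rfl (_root_.sum_pow_three_le (h.mono (by simp)) fun x _ =>
    diffRep_le_card _ x)

/-- A `Γ`-invariant function of differences has constant row sums on `Γ`. -/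
theorem sum_sub_eq_of_invariant {φ : ZMod (p ^ 2) → ℝ}
    (hφ : ∀ a : ZMod p, a ≠ 0 → ∀ x, φ (teich a * x) = φ x) {γ : ZMod (p ^ 2)}
    (hγ : γ ∈ heilbronnGroup p) :
    ((heilbronnGroup p).card : ℝ) * ∑ b ∈ heilbronnGroup p, φ (γ - b)
      = ∑ x, (diffRep (heilbronnGroup p) x : ℝ) * φ x := by
  have hone : ∀ γ ∈ heilbronnGroup p, ∑ b ∈ heilbronnGroup p, φ (γ - b)
      = ∑ b ∈ heilbronnGroup p, φ (1 - b) := by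
    intro γ hγ
    obtain ⟨a, ha, rfl⟩ := mem_heilbronnGroup.1 hγ
    symm
    refine Finset.sum_bij (fun b _ => teich a * b) (fun b hb => (teich_mul_mem_iff ha).2 hb)
      (fun b _ c _ h => (isUnit_teich ha).mul_left_cancel h) (fun b hb => ?_) (fun b _ => ?_)
    · obtain ⟨β, hβ, rfl⟩ := mem_heilbronnGroup.1 hb
      refine ⟨teich (a⁻¹ * β), teich_mem_heilbronnGroup (mul_ne_zero (inv_ne_zero ha) hβ), ?_⟩
      rw [← teich_mul, mul_inv_cancel_left₀ ha]
    · rw [← hφ a ha (1 - b), mul_sub, mul_one]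
  rw [← sum_sum_sub, Finset.sum_congr rfl hone, hone γ hγ]
  simp

end Moments

/-! ### Numerical inequalities and the classical energy bound -/

section Energy

/-- The outcome of combining the lower bound for the triple sum `s` with the two applications of
Cauchy–Schwarz and the moment bounds, for the cut-offs `τ` and `P`. -/
theorem energy_pow_le_of_moment_bounds {e n K L s E₃ W V Q m P τ : ℝ} (he : 0 < e) (hn : 1 ≤ n)
    (hK : 1 ≤ K) (hτ : τ = 16 * K * n ^ 3 / e) (hP : P = 1024 * K ^ 2 * n ^ 8 / e ^ 3)
    (hs : e ^ 3 / (8 * n ^ 3) ≤ s) (hsW : s ^ 2 ≤ E₃ * W) (hE0 : 0 ≤ E₃)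
    (hE : E₃ ≤ 7 * K * n ^ 3 * L)
    (hW : W ^ 2 ≤ m * V * Q) (hm : 0 ≤ m) (hmn : m ≤ 2 * n) (hV0 : 0 ≤ V)
    (hV : V ≤ 4 * (K * n ^ 3) * P) (hQ0 : 0 ≤ Q)
    (hQ : Q ≤ (4 * (K * n ^ 3) * τ) ^ 2 + e ^ 4 / n ^ 3) (he2 : e ^ 2 ≤ 32 * K * n ^ 5) :
    e ^ 17 ≤ 2 ^ 100 * K ^ 17 * n ^ 42 * L ^ 2 := by
  have hn0 : 0 < n := by linarith
  have hK0 : 0 < K := by linarith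
  have hK34 : K ^ 3 ≤ K ^ 4 := pow_le_pow_right₀ hK (by norm_num)
  have he6 : e ^ 6 ≤ 32768 * K ^ 4 * n ^ 15 := by
    calc e ^ 6 = (e ^ 2) ^ 3 := by ring
      _ ≤ (32 * K * n ^ 5) ^ 3 := by gcongr
      _ = 32768 * K ^ 3 * n ^ 15 := by ring
      _ ≤ _ := by gcongr
  have hQ' : Q ≤ 36864 * K ^ 4 * n ^ 12 / e ^ 2 := by
    have h1 : e ^ 4 / n ^ 3 ≤ 32768 * K ^ 4 * n ^ 12 / e ^ 2 := by
      rw [div_le_div_iff₀ (by positivity) (by positivity)]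
      calc e ^ 4 * e ^ 2 = e ^ 6 := by ring
        _ ≤ _ := he6
        _ = _ := by ring
    have h2 : (4 * (K * n ^ 3) * τ) ^ 2 = 4096 * K ^ 4 * n ^ 12 / e ^ 2 := by
      rw [hτ]; field_simp; ring
    calc Q ≤ _ := hQ
      _ ≤ 4096 * K ^ 4 * n ^ 12 / e ^ 2 + 32768 * K ^ 4 * n ^ 12 / e ^ 2 := add_le_add h2.le h1
      _ = _ := by ring
  have hV' : V ≤ 4096 * K ^ 3 * n ^ 11 / e ^ 3 := by
    refine hV.trans (le_of_eq ?_)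
    rw [hP]; field_simp; ring
  have hs0 : 0 ≤ e ^ 3 / (8 * n ^ 3) := by positivity
  have h4 : (e ^ 3 / (8 * n ^ 3)) ^ 4 ≤ (7 * K * n ^ 3 * L) ^ 2 *
      (2 * n * (4096 * K ^ 3 * n ^ 11 / e ^ 3) * (36864 * K ^ 4 * n ^ 12 / e ^ 2)) := by
    calc (e ^ 3 / (8 * n ^ 3)) ^ 4 ≤ s ^ 4 := by gcongr
      _ = (s ^ 2) ^ 2 := by ring
      _ ≤ (E₃ * W) ^ 2 := by gcongr
      _ = E₃ ^ 2 * W ^ 2 := by ring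
      _ ≤ E₃ ^ 2 * (m * V * Q) := by gcongr
      _ ≤ _ := by gcongr
  have h5 : (e ^ 3 / (8 * n ^ 3)) ^ 4 = e ^ 12 / (4096 * n ^ 12) := by field_simp; ring
  have h6 : (7 * K * n ^ 3 * L) ^ 2 *
      (2 * n * (4096 * K ^ 3 * n ^ 11 / e ^ 3) * (36864 * K ^ 4 * n ^ 12 / e ^ 2))
      = 14797504512 * K ^ 9 * n ^ 30 * L ^ 2 / e ^ 5 := by field_simp; ring
  rw [h5, h6, div_le_div_iff₀ (by positivity) (by positivity)] at h4
  calc e ^ 17 = e ^ 12 * e ^ 5 := by ring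
    _ ≤ _ := h4
    _ = (14797504512 * 4096) * K ^ 9 * n ^ 42 * L ^ 2 := by ring
    _ ≤ 2 ^ 100 * K ^ 17 * n ^ 42 * L ^ 2 := by
      have : K ^ 9 ≤ K ^ 17 := pow_le_pow_right₀ hK (by norm_num)
      gcongr
      norm_num

/-- The bound in the range where the cut-off `τ` would exceed `n`. -/
theorem pow_le_of_le_sq {e n K L : ℝ} (he : 0 ≤ e) (hn : 1 ≤ n) (hK : 1 ≤ K) (hL : 1 ≤ L)
    (h : e ≤ 16 * K * n ^ 2) : e ^ 17 ≤ 2 ^ 100 * K ^ 17 * n ^ 42 * L ^ 2 := by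
  have h1 : n ^ 34 ≤ n ^ 42 := pow_le_pow_right₀ hn (by norm_num)
  have h2 : 1 ≤ L ^ 2 := one_le_pow₀ hL
  have h3 : (16 : ℝ) ^ 17 ≤ 2 ^ 100 := by norm_num
  calc e ^ 17 ≤ (16 * K * n ^ 2) ^ 17 := pow_le_pow_left₀ he h 17
    _ = 16 ^ 17 * K ^ 17 * n ^ 34 * 1 := by rw [mul_pow, mul_pow, ← pow_mul, mul_one]
    _ ≤ 2 ^ 100 * K ^ 17 * n ^ 42 * L ^ 2 := mul_le_mul (mul_le_mul
        (mul_le_mul_of_nonneg_right h3 (by positivity)) h1 (by positivity) (by positivity)) h2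
        zero_le_one (by positivity)

/-- The bound in the range where the cut-off `P` would exceed `n`. -/
theorem pow_le_of_cube_le {e n K L : ℝ} (he : 1 ≤ e) (hn : 1 ≤ n) (hK : 1 ≤ K) (hL : 1 ≤ L)
    (h : e ^ 3 ≤ 1024 * K ^ 2 * n ^ 7) : e ^ 17 ≤ 2 ^ 100 * K ^ 17 * n ^ 42 * L ^ 2 := by
  have h1 : K ^ 12 ≤ K ^ 17 := pow_le_pow_right₀ hK (by norm_num)
  have h2 : 1 ≤ L ^ 2 := one_le_pow₀ hL
  have h3 : (1024 : ℝ) ^ 6 ≤ 2 ^ 100 := by norm_num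
  calc e ^ 17 ≤ e ^ 18 := pow_le_pow_right₀ he (by norm_num)
    _ = (e ^ 3) ^ 6 := by rw [← pow_mul]
    _ ≤ (1024 * K ^ 2 * n ^ 7) ^ 6 := pow_le_pow_left₀ (by positivity) h 6
    _ = 1024 ^ 6 * K ^ 12 * n ^ 42 * 1 := by
        rw [mul_pow, mul_pow, ← pow_mul, ← pow_mul, mul_one]
    _ ≤ 2 ^ 100 * K ^ 17 * n ^ 42 * L ^ 2 := mul_le_mul (mul_le_mul_of_nonneg_right
        (mul_le_mul h3 h1 (by positivity) (by positivity)) (by positivity)) h2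
        zero_le_one (by positivity)

variable {p : ℕ} [Fact p.Prime] {K : ℝ}

/-- The classical bound `E(Γ) ≪ |Γ| ^ (5 / 2)`. -/
theorem HasCubicTail.energy_sq_le (h : HasCubicTail p K) {n e : ℝ}
    (hn : n = (heilbronnGroup p).card) (he : e = ∑ x, (diffRep (heilbronnGroup p) x : ℝ) ^ 2)
    (hn0 : 0 < n) (he0 : 0 < e) (he4 : n ^ 2 ≤ e / 4) :
    e ^ 2 ≤ 32 * K * n ^ 5 := by
  -- below the level `e / (4 n²)` the function `r` carries at most a quarter of the energy
  have hT : 0 < e / (4 * n ^ 2) := by positivity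
  have h1 := h.sum_sq_le hT
  rw [← hn] at h1
  have hsum := sum_diffRep (heilbronnGroup p)
  rw [← hn] at hsum
  have h2 : ∑ x with ¬ (e / (4 * n ^ 2) < (diffRep (heilbronnGroup p) x : ℝ)),
      (diffRep (heilbronnGroup p) x : ℝ) ^ 2 ≤ e / 4 := by
    calc _ ≤ ∑ x with ¬ (e / (4 * n ^ 2) < (diffRep (heilbronnGroup p) x : ℝ)),
          e / (4 * n ^ 2) * (diffRep (heilbronnGroup p) x : ℝ) := by
          refine Finset.sum_le_sum fun x hx => ?_
          rw [sq]
          exact mul_le_mul_of_nonneg_right (not_lt.1 (Finset.mem_filter.1 hx).2) (Nat.cast_nonneg _)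
      _ ≤ ∑ x, e / (4 * n ^ 2) * (diffRep (heilbronnGroup p) x : ℝ) :=
          Finset.sum_le_univ_sum_of_nonneg fun x => mul_nonneg hT.le (Nat.cast_nonneg _)
      _ = e / (4 * n ^ 2) * n ^ 2 := by rw [← Finset.mul_sum, ← hsum]
      _ = e / 4 := by field_simp
  have h3 := Finset.sum_filter_add_sum_filter_not Finset.univ
    (fun x => e / (4 * n ^ 2) < (diffRep (heilbronnGroup p) x : ℝ))
    fun x => (diffRep (heilbronnGroup p) x : ℝ) ^ 2
  rw [← he] at h3
  have h4 : e / 2 ≤ 4 * (K * n ^ 3) / (e / (4 * n ^ 2)) := by linarith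
  have h5 : 4 * (K * n ^ 3) / (e / (4 * n ^ 2)) = 16 * K * n ^ 5 / e := by field_simp; ring
  rw [h5, div_le_div_iff₀ (by norm_num) he0] at h4
  nlinarith

end Energy

/-! ### The triple count with truncated representation functions -/

/-- The representation function of `A - A`, cut off to zero where it exceeds `τ`. -/
noncomputable def truncRep {G : Type*} [AddCommGroup G] [DecidableEq G] (A : Finset G) (τ : ℝ)
    (x : G) : ℝ :=
  if (diffRep A x : ℝ) ≤ τ then (diffRep A x : ℝ) else 0

section Truncation

variable {G : Type*} [AddCommGroup G] [DecidableEq G] {A : Finset G} {τ : ℝ}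

theorem truncRep_nonneg (x : G) : 0 ≤ truncRep A τ x := by
  unfold truncRep; split_ifs; exacts [Nat.cast_nonneg _, le_rfl]

theorem truncRep_le (hτ : 0 ≤ τ) (x : G) : truncRep A τ x ≤ τ := by
  unfold truncRep; split_ifs with h; exacts [h, hτ]

theorem truncRep_le_diffRep (x : G) : truncRep A τ x ≤ diffRep A x := by
  unfold truncRep; split_ifs; exacts [le_rfl, Nat.cast_nonneg _]

theorem truncRep_neg [Fintype G] (x : G) : truncRep A τ (-x) = truncRep A τ x := by
  unfold truncRep; rw [diffRep_neg]

theorem truncRep_of_lt {x : G} (h : τ < diffRep A x) : truncRep A τ x = 0 := if_neg (not_le.2 h)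

theorem sum_mul_truncRep [Fintype G] :
    ∑ x, (diffRep A x : ℝ) * truncRep A τ x
      = ∑ x, (diffRep A x : ℝ) ^ 2 - ∑ x with τ < (diffRep A x : ℝ), (diffRep A x : ℝ) ^ 2 := by
  rw [eq_sub_iff_add_eq, Finset.sum_filter, ← Finset.sum_add_distrib]
  refine Finset.sum_congr rfl fun x _ => ?_
  by_cases hx : (diffRep A x : ℝ) ≤ τ
  · rw [truncRep, if_pos hx, if_neg (not_lt.2 hx)]; ring
  · rw [truncRep, if_neg hx, if_pos (not_le.1 hx)]; ring

theorem sum_truncRep_pow_four [Fintype G] :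
    ∑ x, (truncRep A τ x ^ 2) ^ 2
      = ∑ x with (diffRep A x : ℝ) ≤ τ, (diffRep A x : ℝ) ^ 4 := by
  rw [Finset.sum_filter]
  refine Finset.sum_congr rfl fun x _ => ?_
  unfold truncRep
  split_ifs <;> ring

theorem sum_sum_sub_truncRep [Fintype G] (P : ℝ) :
    ∑ a ∈ A, ∑ c ∈ A, ((diffRep A (a - c) : ℝ) - truncRep A P (a - c))
      = ∑ x with P < (diffRep A x : ℝ), (diffRep A x : ℝ) ^ 2 := by
  rw [sum_sum_sub A fun x => (diffRep A x : ℝ) - truncRep A P x]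
  simp only [mul_sub, Finset.sum_sub_distrib]
  rw [sum_mul_truncRep]
  simp [sq]

/-- In a weighted count of triples of `A`, the differences `a - c` with more than `P`
representations contribute at most the common row sum `B` of `g ^ 2` times their energy. -/
theorem triple_le_truncRep_add [Fintype G] {g : G → ℝ} (hg : ∀ x, g (-x) = g x) {B : ℝ}
    (hB : ∀ a ∈ A, ∑ b ∈ A, g (a - b) ^ 2 = B) (P : ℝ) :
    ∑ a ∈ A, ∑ b ∈ A, ∑ c ∈ A, g (a - b) * g (b - c) * (diffRep A (a - c) : ℝ) ≤
      ∑ a ∈ A, ∑ b ∈ A, ∑ c ∈ A, g (a - b) * g (b - c) * truncRep A P ((a - b) + (b - c)) +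
        B * ∑ x with P < (diffRep A x : ℝ), (diffRep A x : ℝ) ^ 2 := by
  have hsplit : ∑ a ∈ A, ∑ b ∈ A, ∑ c ∈ A, g (a - b) * g (b - c) * (diffRep A (a - c) : ℝ)
      = ∑ a ∈ A, ∑ b ∈ A, ∑ c ∈ A, g (a - b) * g (b - c) * truncRep A P ((a - b) + (b - c))
        + ∑ a ∈ A, ∑ c ∈ A, (∑ b ∈ A, g (a - b) * g (b - c)) *
          ((diffRep A (a - c) : ℝ) - truncRep A P (a - c)) := by
    rw [← Finset.sum_add_distrib]
    refine Finset.sum_congr rfl fun a _ => ?_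
    simp only [Finset.sum_mul]
    rw [Finset.sum_comm (s := A) (t := A) (f := fun c b => g (a - b) * g (b - c) *
      ((diffRep A (a - c) : ℝ) - truncRep A P (a - c))), ← Finset.sum_add_distrib]
    refine Finset.sum_congr rfl fun b _ => ?_
    rw [← Finset.sum_add_distrib]
    refine Finset.sum_congr rfl fun c _ => ?_
    rw [sub_add_sub_cancel]
    ring
  rw [hsplit, ← sum_sum_sub_truncRep, Finset.mul_sum]
  refine add_le_add le_rfl (Finset.sum_le_sum fun a ha => ?_)
  rw [Finset.mul_sum]
  refine Finset.sum_le_sum fun c hc =>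
    mul_le_mul_of_nonneg_right ?_ (sub_nonneg.2 (truncRep_le_diffRep _))
  have h2 : ∑ b ∈ A, g (a - b) * g (b - c)
      ≤ ∑ b ∈ A, (g (a - b) ^ 2 / 2 + g (c - b) ^ 2 / 2) := by
    refine Finset.sum_le_sum fun b _ => ?_
    rw [← hg (b - c), neg_sub]
    nlinarith [sq_nonneg (g (a - b) - g (c - b))]
  rw [Finset.sum_add_distrib, ← Finset.sum_div, ← Finset.sum_div, hB a ha, hB c hc] at h2
  linarith

end Truncation

section Bound

variable {p : ℕ} [Fact p.Prime] {K : ℝ}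

theorem truncRep_teich_mul (τ : ℝ) {a : ZMod p} (ha : a ≠ 0) (x : ZMod (p ^ 2)) :
    truncRep (heilbronnGroup p) τ (teich a * x) = truncRep (heilbronnGroup p) τ x := by
  unfold truncRep; rw [diffRep_teich_mul ha]

theorem truncRep_of_redModP_eq_zero {τ : ℝ} (hτ : τ < (heilbronnGroup p).card)
    {x : ZMod (p ^ 2)} (hx : redModP p x = 0) : truncRep (heilbronnGroup p) τ x = 0 := by
  by_cases hx0 : x = 0
  · subst hx0
    exact truncRep_of_lt (by rwa [diffRep_zero])
  · have h0 : diffRep (heilbronnGroup p) x = 0 := by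
      by_contra h
      exact redModP_ne_zero_of_diffRep hx0 h hx
    unfold truncRep
    simp [h0]

/-- The triples all of whose differences have few representations already give a positive
proportion of the lower bound `E(Γ)³ / |Γ|³`. -/
theorem HasCubicTail.triple_truncRep_ge (h : HasCubicTail p K) (hK : 1 ≤ K) {n e τ P : ℝ}
    (hn : n = (heilbronnGroup p).card) (he : e = ∑ x, (diffRep (heilbronnGroup p) x : ℝ) ^ 2)
    (hn0 : 0 < n) (he0 : 0 < e) (he4 : n ^ 2 ≤ e / 4) (hτ : τ = 16 * K * n ^ 3 / e)
    (hP : P = 1024 * K ^ 2 * n ^ 8 / e ^ 3) (hPn : P < n) :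
    e ^ 3 / (8 * n ^ 3) ≤ ∑ a ∈ heilbronnGroup p, ∑ b ∈ heilbronnGroup p, ∑ c ∈ heilbronnGroup p,
      truncRep (heilbronnGroup p) τ (a - b) * truncRep (heilbronnGroup p) τ (b - c) *
        truncRep (heilbronnGroup p) P ((a - b) + (b - c)) := by
  have hK0 : 0 < K := by linarith
  have hτ0 : 0 < τ := by rw [hτ]; positivity
  have hP0 : 0 < P := by rw [hP]; positivity
  set A := heilbronnGroup p with hA
  set g := truncRep A τ with hg
  obtain ⟨μ, hμ⟩ : ∃ μ, μ = (∑ x, (diffRep A x : ℝ) * g x) / n := ⟨_, rfl⟩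
  obtain ⟨B, hB⟩ : ∃ B, B = (∑ x, (diffRep A x : ℝ) * g x ^ 2) / n := ⟨_, rfl⟩
  have hμrow : ∀ a ∈ A, ∑ b ∈ A, g (a - b) = μ := fun a ha => by
    rw [hμ, eq_div_iff hn0.ne', mul_comm, hn]
    exact sum_sub_eq_of_invariant (fun a ha x => truncRep_teich_mul τ ha x) ha
  have hBrow : ∀ a ∈ A, ∑ b ∈ A, g (a - b) ^ 2 = B := fun a ha => by
    rw [hB, eq_div_iff hn0.ne', mul_comm, hn]
    exact sum_sub_eq_of_invariant (φ := fun x => g x ^ 2)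
      (fun a ha x => by simp only [hg, hA, truncRep_teich_mul τ ha x]) ha
  have hμle : e / (2 * n) ≤ μ := by
    have h1 := h.sum_sq_le hτ0
    rw [← hA, ← hn] at h1
    have h4 : 4 * (K * n ^ 3) / τ = e / 4 := by rw [hτ]; field_simp; ring
    rw [h4] at h1
    have h5 : e / 2 ≤ ∑ x, (diffRep A x : ℝ) * g x := by
      rw [hg, sum_mul_truncRep, ← he]
      linarith
    rw [hμ, le_div_iff₀ hn0]
    refine le_trans (le_of_eq ?_) h5
    field_simp
  have hBle : B ≤ 16 * K * n ^ 2 := by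
    have h1 : ∑ x, (diffRep A x : ℝ) * g x ^ 2 ≤ τ * e := by
      rw [he, Finset.mul_sum]
      refine Finset.sum_le_sum fun x _ => ?_
      have hr : (0 : ℝ) ≤ diffRep A x := Nat.cast_nonneg _
      calc (diffRep A x : ℝ) * g x ^ 2 = diffRep A x * (g x * g x) := by ring
        _ ≤ diffRep A x * (τ * diffRep A x) := mul_le_mul_of_nonneg_left
            (mul_le_mul (truncRep_le hτ0.le x) (truncRep_le_diffRep x) (truncRep_nonneg x) hτ0.le)
            hr
        _ = τ * diffRep A x ^ 2 := by ring
    rw [hB, div_le_iff₀ hn0]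
    refine h1.trans (le_of_eq ?_)
    rw [hτ]; field_simp
  have hlarge : B * ∑ x with P < (diffRep A x : ℝ), (diffRep A x : ℝ) ^ 2
      ≤ e ^ 3 / (8 * n ^ 3) := by
    have h4 := h.sum_sq_le hP0
    rw [← hA, ← hn] at h4
    have h5 : n ^ 2 + 4 * (K * n ^ 3) / P ≤ 5 * K * n ^ 3 / P := by
      rw [← sub_nonneg]
      have e1 : 5 * K * n ^ 3 / P - (n ^ 2 + 4 * (K * n ^ 3) / P) = n ^ 2 * (K * n - P) / P := by
        field_simp; ring
      rw [e1]
      have : P ≤ K * n := by nlinarith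
      have : 0 ≤ K * n - P := by linarith
      positivity
    calc _ ≤ (16 * K * n ^ 2) * (5 * K * n ^ 3 / P) :=
          mul_le_mul hBle (h4.trans h5) (Finset.sum_nonneg fun x _ => sq_nonneg _) (by positivity)
      _ = 80 / 1024 * (e ^ 3 / n ^ 3) := by rw [hP]; field_simp; ring
      _ ≤ 1 / 8 * (e ^ 3 / n ^ 3) := mul_le_mul_of_nonneg_right (by norm_num) (by positivity)
      _ = _ := by field_simp
  have htotal := sq_mul_energy_le_triple A (fun x => truncRep_neg x) hμrow
  rw [← he, ← hn] at htotal
  have hsplit := triple_le_truncRep_add (fun x => truncRep_neg x) hBrow P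
  have h1 : e ^ 3 / (4 * n ^ 3) * n ≤ μ ^ 2 * e := by
    calc e ^ 3 / (4 * n ^ 3) * n = (e / (2 * n)) ^ 2 * e := by field_simp; ring
      _ ≤ μ ^ 2 * e := by gcongr
  have h2 : e ^ 3 / (4 * n ^ 3) ≤ ∑ a ∈ A, ∑ b ∈ A, ∑ c ∈ A,
      g (a - b) * g (b - c) * (diffRep A (a - c) : ℝ) := by
    refine le_of_mul_le_mul_right ?_ hn0
    rw [mul_comm (Finset.sum _ _)]
    exact h1.trans htotal
  have h3 : e ^ 3 / (4 * n ^ 3) = e ^ 3 / (8 * n ^ 3) + e ^ 3 / (8 * n ^ 3) := by field_simp; ring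
  linarith

theorem HasCubicTail.sum_pow_three_le_logb (h : HasCubicTail p K) (hK : 1 ≤ K) {n : ℝ}
    (hn : n = (heilbronnGroup p).card) (hn2 : 2 ≤ n) (hL1 : 1 ≤ Real.logb 2 n) :
    ∑ x, (diffRep (heilbronnGroup p) x : ℝ) ^ 3 ≤ 7 * K * n ^ 3 * Real.logb 2 n := by
  have hS3 := h.sum_pow_three_le
  rw [← hn] at hS3
  set L := Real.logb 2 n with hL
  have hlog : Real.log n ≤ L := by
    have h1 : Real.log n = L * Real.log 2 := by
      rw [hL, Real.logb, div_mul_cancel₀ _ (by positivity)]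
    rw [h1]
    have := Real.log_two_lt_d9
    nlinarith
  clear_value L
  have hn0 : 0 < n := by linarith
  have h2 : n ^ 3 ≤ K * n ^ 3 * L := by
    have : 1 ≤ K * L := by nlinarith
    nlinarith [pow_pos hn0 3]
  have h3 : 3 * (K * n ^ 3) * (1 + Real.log n) ≤ 3 * (K * n ^ 3) * (2 * L) :=
    mul_le_mul_of_nonneg_left (by linarith) (by positivity)
  calc _ ≤ _ := hS3
    _ ≤ _ := add_le_add h2 h3
    _ = _ := by ring

/-- `sq_weighted_count_le` for the squares of the truncated representation functions. -/
theorem sq_truncRep_count_le {n e τ : ℝ} (P : ℝ) (hp : 3 ≤ p)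
    (hn : n = (heilbronnGroup p).card) (he : e = ∑ x, (diffRep (heilbronnGroup p) x : ℝ) ^ 2)
    (hτn : τ < n) :
    (∑ x, ∑ y, (truncRep (heilbronnGroup p) τ x * truncRep (heilbronnGroup p) τ y *
        truncRep (heilbronnGroup p) P (x + y)) ^ 2) ^ 2 ≤
      p * (∑ z, (truncRep (heilbronnGroup p) P z ^ 2) ^ 2) *
        ((∑ x, (truncRep (heilbronnGroup p) τ x ^ 2) ^ 2) ^ 2 + e ^ 4 / n ^ 3) := by
  have hW := sq_weighted_count_le (redModP p) (fun x => isUnit_of_redModP_ne_zero)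
    (Γ := heilbronnGroup p)
    (fun x hx y hy hxy => by rw [← teich_redModP hx, hxy, teich_redModP hy])
    (fun γ hγ => redModP_ne_zero hγ)
    (Finset.card_pos.1 (by rw [card_heilbronnGroup]; omega))
    (u := fun x => truncRep (heilbronnGroup p) τ x ^ 2)
    (fun x => truncRep (heilbronnGroup p) P x ^ 2) (fun x => sq_nonneg _)
    (fun γ hγ x => by
      obtain ⟨a, ha, rfl⟩ := mem_heilbronnGroup.1 hγ
      simp only [truncRep_teich_mul τ ha])
    (fun x hx => by
      simp only [truncRep_of_redModP_eq_zero (by rwa [← hn]) hx]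
      norm_num)
  rw [ZMod.card, ← hn] at hW
  simp only [mul_pow]
  refine hW.trans (mul_le_mul_of_nonneg_left (add_le_add le_rfl ?_)
    (mul_nonneg (Nat.cast_nonneg p) (Finset.sum_nonneg fun x _ => sq_nonneg _)))
  refine div_le_div_of_nonneg_right (pow_le_pow_left₀
    (Finset.sum_nonneg fun x _ => sq_nonneg _) ?_ 4) (by rw [hn]; positivity)
  rw [he]
  exact Finset.sum_le_sum fun x _ => pow_le_pow_left₀ (truncRep_nonneg x) (truncRep_le_diffRep x) 2

theorem HasCubicTail.energy_pow_le (h : HasCubicTail p K) (hK : 1 ≤ K) (hp : 3 ≤ p) {n e : ℝ}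
    (hn : n = (heilbronnGroup p).card) (he : e = ∑ x, (diffRep (heilbronnGroup p) x : ℝ) ^ 2) :
    e ^ 17 ≤ 2 ^ 100 * K ^ 17 * n ^ 42 * Real.logb 2 n ^ 2 := by
  have hn2 : (2 : ℝ) ≤ n := by
    rw [hn, card_heilbronnGroup]; exact_mod_cast (by omega : 2 ≤ p - 1)
  have hpn : (p : ℝ) ≤ 2 * n := by
    rw [hn, card_heilbronnGroup]; exact_mod_cast (by omega : p ≤ 2 * (p - 1))
  have hn0 : 0 < n := by linarith
  have hn1 : 1 ≤ n := by linarith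
  have hK0 : 0 < K := by linarith
  have hL1 : 1 ≤ Real.logb 2 n := by
    rw [Real.le_logb_iff_rpow_le (by norm_num) hn0]
    simpa using hn2
  have hen : n ^ 2 ≤ e := by
    have h0 := Finset.single_le_sum (f := fun x => (diffRep (heilbronnGroup p) x : ℝ) ^ 2)
      (fun x _ => sq_nonneg _) (Finset.mem_univ 0)
    rw [diffRep_zero, ← hn, ← he] at h0
    exact h0
  have he1 : 1 ≤ e := le_trans (by nlinarith) hen
  have he0 : 0 < e := by linarith
  rcases le_or_gt e (16 * K * n ^ 2) with hsmall | hsmall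
  · exact pow_le_of_le_sq he0.le hn1 hK hL1 hsmall
  rcases le_or_gt (e ^ 3) (1024 * K ^ 2 * n ^ 7) with hmid | hmid
  · exact pow_le_of_cube_le he1 hn1 hK hL1 hmid
  have he4 : n ^ 2 ≤ e / 4 := by nlinarith [sq_nonneg n]
  -- `τ` is the level above which `r` carries at most half of the energy; `P` is the level above
  -- which the differences `a - c` carry at most half of the lower bound for the triple sum
  obtain ⟨τ, hτ⟩ : ∃ τ, τ = 16 * K * n ^ 3 / e := ⟨_, rfl⟩
  obtain ⟨P, hP⟩ : ∃ P, P = 1024 * K ^ 2 * n ^ 8 / e ^ 3 := ⟨_, rfl⟩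
  have hτ0 : 0 < τ := by rw [hτ]; positivity
  have hP0 : 0 < P := by rw [hP]; positivity
  have hτn : τ < n := by rw [hτ, div_lt_iff₀ he0]; nlinarith
  have hPn : P < n := by rw [hP, div_lt_iff₀ (by positivity)]; nlinarith
  have hV := h.sum_pow_four_le hP0.le (by rwa [← hn])
  have hU := h.sum_pow_four_le hτ0.le (by rwa [← hn])
  rw [← sum_truncRep_pow_four, ← hn] at hV hU
  refine energy_pow_le_of_moment_bounds he0 hn1 hK hτ hP
    (h.triple_truncRep_ge hK hn he hn0 he0 he4 hτ hP hPn)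
    (sq_triple_le_energy_three _ fun x y => truncRep (heilbronnGroup p) τ x *
      truncRep (heilbronnGroup p) τ y * truncRep (heilbronnGroup p) P (x + y))
    (Finset.sum_nonneg fun x _ => pow_nonneg (Nat.cast_nonneg _) 3)
    (h.sum_pow_three_le_logb hK hn hn2 hL1) (sq_truncRep_count_le P hp hn he hτn)
    (Nat.cast_nonneg p) hpn (Finset.sum_nonneg fun x _ => sq_nonneg _) hV (by positivity)
    (add_le_add (pow_le_pow_left₀ (Finset.sum_nonneg fun x _ => sq_nonneg _) hU 2) le_rfl)
    (h.energy_sq_le hn he hn0 he0 he4)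

end Bound

/-! ### The energy bound -/

theorem theorem4 :
    ∃ C : ℝ, 0 < C ∧ ∀ p : ℕ, p.Prime → 3 ≤ p →
      (Finset.addEnergy (heilbronnGroup p) (heilbronnGroup p) : ℝ) ≤
        C * ((heilbronnGroup p).card : ℝ) ^ (42 / 17 : ℝ) *
          (Real.logb 2 ((heilbronnGroup p).card : ℝ)) ^ (10 / 17 : ℝ) := by
  refine ⟨2 ^ 100 * 16384000, by positivity, fun p hp hp3 => ?_⟩
  have : Fact p.Prime := ⟨hp⟩
  have key := (hasCubicTail_heilbronnGroup p).energy_pow_le (by norm_num) hp3 rfl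
    (addEnergy_eq_sum_diffRep_sq _)
  set e : ℝ := (Finset.addEnergy (heilbronnGroup p) (heilbronnGroup p) : ℝ) with he
  have hn2 : (2 : ℝ) ≤ (heilbronnGroup p).card := by
    rw [card_heilbronnGroup]; exact_mod_cast (by omega : 2 ≤ p - 1)
  set n : ℝ := ((heilbronnGroup p).card : ℝ) with hn
  set L := Real.logb 2 n with hL
  have hn0 : 0 < n := by linarith
  have hL1 : 1 ≤ L := by
    rw [hL, Real.le_logb_iff_rpow_le (by norm_num) hn0]
    simpa using hn2
  have hL0 : 0 < L := by linarith
  refine le_of_pow_le_pow_left₀ (n := 17) (by norm_num) (by positivity) ?_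
  have h1 : (n ^ (42 / 17 : ℝ)) ^ 17 = n ^ 42 := by
    rw [← Real.rpow_natCast, ← Real.rpow_mul hn0.le, ← Real.rpow_natCast]; norm_num
  have h2 : (L ^ (10 / 17 : ℝ)) ^ 17 = L ^ 10 := by
    rw [← Real.rpow_natCast, ← Real.rpow_mul hL0.le, ← Real.rpow_natCast]; norm_num
  rw [mul_pow, mul_pow, h1, h2]
  refine key.trans ?_
  have h3 : L ^ 2 ≤ L ^ 10 := pow_le_pow_right₀ hL1 (by norm_num)
  rw [mul_pow]
  gcongr
  exact le_self_pow₀ (by norm_num) (by norm_num)
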